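/- Let $(\Omega,\mathcal F,\mathbf P)$ be a probability space with a filtration $(\mathcal F_t)_{t=0}^T$ of $\mathbf P$-complete $\sigma$-algebras, $\mathcal F_0$ trivial (every event has probability $0$ or $1$) and $\mathcal F_T=\mathcal F$. Let $(S_t)_{t=0}^T$ be an adapted $\mathbb R^d$-valued process (discounted prices), and for $0\le t\le T-1$ let $B_t$ be an $\mathcal F_t$-measurable set-valued map whose values $B_t(\omega)\subset\mathbb R^d$ are polyhedral convex cones. An admissible strategy is an adapted process $\gamma=(\gamma_t)_{t=0}^{T-1}$ with $\gamma_t\in B_t$ a.s.; its gain is $G_T^\gamma=\sum_{n=1}^T\langle\gamma_{n-1},S_n-S_{n-1}\rangle$. Assume no arbitrage: for every admissible $\gamma$, $G_T^\gamma\ge0$ a.s. implies $G_T^\gamma=0$ a.s. Let $f_T$ be an $\mathcal F_T$-measurable real random variable. Its upper price is the infimum of all $x\in\mathbb R$ such that $x+G_T^\gamma\ge f_T$ a.s. for some admissible $\gamma$, and its lower price is the supremum of all $x\in\mathbb R$ such that $x-G_T^\gamma\le f_T$ a.s. for some admissible $\gamma$. Assume that both prices are finite. For an $\mathbb R^{d}\times\mathbb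 R$-valued random vector $\eta$ let $\mathcal K(\eta,\mathcal F_t)$ be the ($\omega$-dependent) support of the regular conditional distribution of $\eta$ given $\mathcal F_t$. Let $B_t^\circ=\{y\in\mathbb R^d:\langle x,y\rangle\le0\ \ \forall x\in B_t\}$, so that $B_t^\circ\times\{0\}$ is the polar cone of $B_t\times\mathbb R$; let $\mathrm{ri}$ and $\mathrm{conv}$ denote the relative interior and the convex hull, and let $A-A'=\{a-a':a\in A,\ a'\in A'\}$. Then there are real-valued adapted processes $(\overline\pi_t)_{t=0}^T$ and $(\underline\pi_t)_{t=0}^T$, each unique up to a.s. equality, such that $\overline\pi_T=\underline\pi_T=f_T$ a.s. and, for $0\le t\le T-1$, a.s. $$\overline\pi_t=\sup\{y\in\mathbb R:(S_t,y)\in\mathrm{ri}(\mathrm{conv}\,\mathcal K((S_{t+1},\overline\pi_{t+1}),\mathcal F_t))-B_t^\circ\times\{0\}\},$$ $$\underline\pi_t=\inf\{y\in\mathbb R:(S_t,y)\in\mathrm{ri}(\mathrm{conv}\,\mathcal K((S_{t+1},\underline\pi_{t+1}),\mathcal F_t))-B_t^\circ\times\{0\}\},$$ where the sets are nonempty and the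 supremum and infimum are finite a.s. Moreover, $\overline\pi_0$ equals the upper price of $f_T$ and $\underline\pi_0$ equals the lower price of $f_T$ a.s. -/

import Mathlib

open MeasureTheory ProbabilityTheory Set
open scoped Pointwise

noncomputable section

namespace ConstrainedMarket

variable {d : ℕ} {Ω : Type*}

/-- A polyhedral convex cone: the intersection of finitely many closed half-spaces whose bounding
hyperplanes pass through the origin (finitely many linear inequalities). -/
def IsPolyhedralCone (A : Set (EuclideanSpace ℝ (Fin d))) : Prop :=
  ∃ s : Finset (EuclideanSpace ℝ (Fin d)), A = {x | ∀ a ∈ s, inner ℝ a x ≤ 0}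

/-- Measurability of a set-valued map with respect to the sigma-algebra `m`: the set of `ω` at
which the value meets a given open set belongs to `m`. -/
def IsMeasurableSetValued (m : MeasurableSpace Ω)
    (G : Ω → Set (EuclideanSpace ℝ (Fin d))) : Prop :=
  ∀ U : Set (EuclideanSpace ℝ (Fin d)), IsOpen U → MeasurableSet[m] {ω | (G ω ∩ U).Nonempty}

/-- The polar cone `A° = {y : ⟨x, y⟩ ≤ 0 for all x ∈ A}`. -/
def polarCone (A : Set (EuclideanSpace ℝ (Fin d))) : Set (EuclideanSpace ℝ (Fin d)) :=
  {y | ∀ x ∈ A, inner ℝ x y ≤ 0}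

/-- The discounted gain `G_t = ∑_{n=1}^t ⟨γ_{n-1}, S_n - S_{n-1}⟩` of a portfolio process. -/
def gain (S γ : ℕ → Ω → EuclideanSpace ℝ (Fin d)) (t : ℕ) (ω : Ω) : ℝ :=
  ∑ n ∈ Finset.range t, inner ℝ (γ n ω) (S (n + 1) ω - S n ω)

/-- The support `𝒦(η, 𝓗; ω)` of the regular conditional distribution of the random vector `η`
with respect to the sub-sigma-algebra `m`. The regular conditional distribution is the conditional
distribution of `η` given the identity map from `Ω` to `Ω` equipped with `m`. -/
def condSupport {mΩ : MeasurableSpace Ω} (μ : Measure Ω) [IsFiniteMeasure μ]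
    (m : MeasurableSpace Ω) (η : Ω → EuclideanSpace ℝ (Fin d) × ℝ) (ω : Ω) :
    Set (EuclideanSpace ℝ (Fin d) × ℝ) :=
  (@condDistrib Ω Ω (EuclideanSpace ℝ (Fin d) × ℝ) _ _ _ mΩ m η id μ _ ω).support

variable {mΩ : MeasurableSpace Ω} (μ : Measure Ω) (F : Filtration ℕ mΩ) (T : ℕ)
  (S : ℕ → Ω → EuclideanSpace ℝ (Fin d)) (B : ℕ → Ω → Set (EuclideanSpace ℝ (Fin d)))

/-- Admissible portfolio processes: `γ_n` is `F_n`-measurable and `γ_n ∈ B_n` a.s. at each of the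
trading times `n = 0, …, T - 1`. -/
def IsAdmissible (γ : ℕ → Ω → EuclideanSpace ℝ (Fin d)) : Prop :=
  ∀ n < T, Measurable[F n] (γ n) ∧ ∀ᵐ ω ∂μ, γ n ω ∈ B n ω

/-- The no-arbitrage condition. -/
def NoArbitrage : Prop :=
  ∀ γ : ℕ → Ω → EuclideanSpace ℝ (Fin d), IsAdmissible μ F T B γ →
    (∀ᵐ ω ∂μ, 0 ≤ gain S γ T ω) → ∀ᵐ ω ∂μ, gain S γ T ω = 0

/-- The claim `f` can be super-hedged at the price `x`. -/
def IsSuperHedgeable (f : Ω → ℝ) (x : ℝ) : Prop :=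
  ∃ γ : ℕ → Ω → EuclideanSpace ℝ (Fin d), IsAdmissible μ F T B γ ∧
    ∀ᵐ ω ∂μ, f ω ≤ x + gain S γ T ω

/-- The claim `f` can be sub-hedged at the price `x`. -/
def IsSubHedgeable (f : Ω → ℝ) (x : ℝ) : Prop :=
  ∃ γ : ℕ → Ω → EuclideanSpace ℝ (Fin d), IsAdmissible μ F T B γ ∧
    ∀ᵐ ω ∂μ, x - gain S γ T ω ≤ f ω

/-- The upper price: the infimum, in the extended reals, of the super-hedging prices. -/
def upperPrice (f : Ω → ℝ) : EReal :=
  sInf ((fun x : ℝ => (x : EReal)) '' {x | IsSuperHedgeable μ F T S B f x})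

/-- The lower price: the supremum, in the extended reals, of the sub-hedging prices. -/
def lowerPrice (f : Ω → ℝ) : EReal :=
  sSup ((fun x : ℝ => (x : EReal)) '' {x | IsSubHedgeable μ F T S B f x})

/-- The set of all `y` with `(S_t, y) ∈ ri (conv 𝒦((S_{t+1}, p), F_t)) - B_t°` at `ω`. The claim is
traded without constraints, so the constraint cone in `ℝ^d × ℝ` is `B_t × ℝ`; its polar is
`B_t° × {0}`, which is the meaning of `B_t°` as a subset of `ℝ^d × ℝ`. -/
def stepValues [IsFiniteMeasure μ] (t : ℕ) (p : Ω → ℝ) (ω : Ω) : Set ℝ :=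
  {y | (S t ω, y) ∈
    intrinsicInterior ℝ (convexHull ℝ (condSupport μ (F t) (fun ω' => (S (t + 1) ω', p ω')) ω))
      - polarCone (B t ω) ×ˢ ({0} : Set ℝ)}

/-- `π` is a (finite) adapted solution of the backward recursion for the upper price:
`π_T = f`, and `π_t` is the supremum of the step values built from `π_{t+1}`. -/
def IsUpperRecursion [IsFiniteMeasure μ] (f : Ω → ℝ) (π : ℕ → Ω → ℝ) : Prop :=
  (∀ t ≤ T, Measurable[F t] (π t)) ∧ (∀ᵐ ω ∂μ, π T ω = f ω) ∧
    ∀ t < T, ∀ᵐ ω ∂μ, IsLUB (stepValues μ F S B t (π (t + 1)) ω) (π t ω)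

/-- `π` is a (finite) adapted solution of the backward recursion for the lower price:
`π_T = f`, and `π_t` is the infimum of the step values built from `π_{t+1}`. -/
def IsLowerRecursion [IsFiniteMeasure μ] (f : Ω → ℝ) (π : ℕ → Ω → ℝ) : Prop :=
  (∀ t ≤ T, Measurable[F t] (π t)) ∧ (∀ᵐ ω ∂μ, π T ω = f ω) ∧
    ∀ t < T, ∀ᵐ ω ∂μ, IsGLB (stepValues μ F S B t (π (t + 1)) ω) (π t ω)

end ConstrainedMarket

end

/-! The core is a duality for one period with `ω` frozen. Let `K` be the conditional support, `A`
the constraint cone and `s` the current price. If a portfolio in `A` with capital `x` dominates on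
`K`, then conv `K` lies in a half-space, and subtracting the polar cone does not raise the bound at
`s`: every reachable value is at most `x` (`le_of_mem_reachableValues`). Conversely, if `x` exceeds
all reachable values, the upward ray from `(s, x)`, enlarged by the cone of normals of `A`, misses
ri conv `K`. As this cone is finitely generated, some hyperplane separates the two without
containing `K` (`exists_proper_separation_cone`). The absence of arbitrage keeps it from being
vertical, and dividing by its last coefficient gives a hedge (`hedgeSet_nonempty_of_lt`). So the
supremum of the reachable values is the infimum of the hedging capitals.

The passage from `ω` to the market rests on two facts. A weak inequality holds a.s. exactly when it
holds on the whole conditional support (`ae_hedge_iff`), and the hedge sets form a measurable closed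
convex map, so nearest points are measurable selections. These selections carry the absence of
arbitrage to almost every `ω` (`ae_noOneStepArbitrage`) and assemble one-step hedges.

Backward in time, any super-hedge from capital `x` keeps the recursion finite, since `x` plus its
running gain dominates each step. Hedging each period with a surplus `ε` shows that the initial
value, constant because the initial sigma-algebra is trivial, is the upper price. The lower price
follows by reflecting the claim coordinate. -/

noncomputable section

namespace ConstrainedMarket

/-! ### Relative interiors of convex sets. -/

section RelativeInterior

variable {V : Type*} [NormedAddCommGroup V] [NormedSpace ℝ V]

theorem mem_intrinsicInterior_iff_ball {C : Set V} {x : V} :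
    x ∈ intrinsicInterior ℝ C ↔
      x ∈ C ∧ ∃ ε > 0, ∀ y ∈ affineSpan ℝ C, dist y x < ε → y ∈ C := by
  rw [mem_intrinsicInterior]
  constructor
  · rintro ⟨y, hy, rfl⟩
    refine ⟨interior_subset (s := ((↑) : affineSpan ℝ C → V) ⁻¹' C) hy, ?_⟩
    obtain ⟨ε, hε, h⟩ := Metric.isOpen_iff.1 isOpen_interior y hy
    refine ⟨ε, hε, fun z hz hd => ?_⟩
    have hmem : (⟨z, hz⟩ : affineSpan ℝ C) ∈ Metric.ball y ε := hd
    exact interior_subset (s := ((↑) : affineSpan ℝ C → V) ⁻¹' C) (h hmem)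
  · rintro ⟨hx, ε, hε, h⟩
    refine ⟨⟨x, subset_affineSpan _ _ hx⟩, ?_, rfl⟩
    rw [mem_interior_iff_mem_nhds, Metric.mem_nhds_iff]
    exact ⟨ε, hε, fun z hz => h z z.2 hz⟩

/-- A perturbation of the combination inside the affine span can be charged to `x` alone, magnified
by `1 / a`; hence the radius `a * ε`. -/
theorem combo_mem_intrinsicInterior {C : Set V} (hC : Convex ℝ C) {x y : V}
    (hx : x ∈ intrinsicInterior ℝ C) (hy : y ∈ C) {a b : ℝ} (ha : 0 < a) (hb : 0 ≤ b)
    (hab : a + b = 1) : a • x + b • y ∈ intrinsicInterior ℝ C := by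
  rw [mem_intrinsicInterior_iff_ball] at hx ⊢
  obtain ⟨hxC, ε, hε, h⟩ := hx
  have hzC : a • x + b • y ∈ C := hC hxC hy ha.le hb hab
  refine ⟨hzC, a * ε, by positivity, fun w hw hd => ?_⟩
  set x' : V := a⁻¹ • (w - (a • x + b • y)) + x with hx'
  have hx'A : x' ∈ affineSpan ℝ C := by
    have h1 : w -ᵥ (a • x + b • y) ∈ (affineSpan ℝ C).direction :=
      AffineSubspace.vsub_mem_direction hw (subset_affineSpan _ _ hzC)
    exact AffineSubspace.vadd_mem_of_mem_direction
      (Submodule.smul_mem _ a⁻¹ h1) (subset_affineSpan _ _ hxC)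
  have hx'C : x' ∈ C := by
    refine h _ hx'A ?_
    rw [dist_eq_norm] at hd ⊢
    rw [hx', add_sub_cancel_right, norm_smul, norm_inv, Real.norm_of_nonneg ha.le,
      inv_mul_lt_iff₀ ha]
    exact hd
  have : w = a • x' + b • y := by
    rw [hx', smul_add, smul_smul, mul_inv_cancel₀ ha.ne']
    module
  rw [this]
  exact hC hx'C hy ha.le hb hab

theorem convex_intrinsicInterior {C : Set V} (hC : Convex ℝ C) :
    Convex ℝ (intrinsicInterior ℝ C) := by
  intro x hx y hy a b ha hb hab
  rcases ha.eq_or_lt with rfl | ha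
  · have : b = 1 := by linarith
    subst this; simpa using hy
  · exact combo_mem_intrinsicInterior hC hx (intrinsicInterior_subset hy) ha hb hab

end RelativeInterior

/-! ### Proper separation in finite dimension. -/

section Separation

variable {V : Type*} [NormedAddCommGroup V] [NormedSpace ℝ V] [FiniteDimensional ℝ V]

/-- A nonempty convex set in a finite-dimensional space can be properly separated from the origin
if it does not contain it. -/
theorem exists_proper_separation_zero {U : Set V} (hU : Convex ℝ U) (hne : U.Nonempty)
    (h0 : (0 : V) ∉ U) :
    ∃ l : V →ₗ[ℝ] ℝ, (∀ u ∈ U, l u ≤ 0) ∧ ∃ u ∈ U, l u < 0 := by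
  set D := Submodule.span ℝ U with hD
  set W : Set D := (↑) ⁻¹' (ConvexCone.hull ℝ U : Set V) with hW
  have hWc : Convex ℝ W := (ConvexCone.hull ℝ U).convex.linear_preimage D.subtype
  have hmemW : ∀ {x : D}, x ∈ W ↔ ∃ r : ℝ, 0 < r ∧ ∃ y ∈ U, r • y = x := fun {x} =>
    ConvexCone.mem_hull_of_convex hU
  have hUW : ∀ (u : V) (hu : u ∈ U), (⟨u, Submodule.subset_span hu⟩ : D) ∈ W := by
    intro u hu
    exact hmemW.2 ⟨1, one_pos, u, hu, one_smul _ _⟩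
  have hWne : W.Nonempty := hne.elim fun u hu => ⟨_, hUW u hu⟩
  -- The cone contains `x` and `2x` for each `x` in `U`, so its directions contain `U` and hence the
  -- whole span; it therefore has interior there.
  have hspan : affineSpan ℝ W = ⊤ := by
    rw [AffineSubspace.affineSpan_eq_top_iff_vectorSpan_eq_top_of_nonempty _ _ _ hWne]
    rw [eq_top_iff, ← Submodule.span_span_coe_preimage (R := ℝ) (s := U), Submodule.span_le]
    intro x hx
    have h1 : x ∈ W := hmemW.2 ⟨1, one_pos, x, hx, one_smul _ _⟩
    have h2 : (2 : ℝ) • x ∈ W := hmemW.2 ⟨2, two_pos, x, hx, rfl⟩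
    have h3 := vsub_mem_vectorSpan ℝ h2 h1
    have h4 : (2 : ℝ) • x -ᵥ x = x := by rw [vsub_eq_sub, two_smul, add_sub_cancel_right]
    rwa [h4] at h3
  have hint : (interior W).Nonempty := hWc.interior_nonempty_iff_affineSpan_eq_top.2 hspan
  have h0W : (0 : D) ∉ interior W := by
    intro h
    obtain ⟨c, hc, y, hy, hcy⟩ := hmemW.1 (interior_subset (s := W) h)
    have : y = 0 := (smul_eq_zero.1 hcy).resolve_left hc.ne'
    exact h0 (this ▸ hy)
  obtain ⟨f, hf⟩ := geometric_hahn_banach_open_point hWc.interior isOpen_interior h0W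
  obtain ⟨l, hl⟩ := LinearMap.exists_extend (f : D →ₗ[ℝ] ℝ)
  have hl' : ∀ x : D, l x = f x := fun x => LinearMap.congr_fun hl x
  refine ⟨l, fun u hu => ?_, ?_⟩
  · have hmem : (⟨u, Submodule.subset_span hu⟩ : D) ∈ closure (interior W) := by
      rw [hWc.closure_interior_eq_closure_of_nonempty_interior hint]
      exact subset_closure (hUW u hu)
    have hcl : closure (interior W) ⊆ {x | f x ≤ 0} :=
      closure_minimal (fun x hx => by simpa using (hf x hx).le)
        (isClosed_le f.continuous continuous_const)
    have := hcl hmem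
    simpa [← hl'] using this
  · obtain ⟨w, hw⟩ := hint
    obtain ⟨c, hc, y, hy, hcy⟩ := hmemW.1 (interior_subset (s := W) hw)
    refine ⟨y, hy, ?_⟩
    have h1 : l w < 0 := by simpa [hl'] using hf w hw
    rw [← hcy, map_smul, smul_eq_mul] at h1
    exact (pos_iff_neg_of_mul_neg h1).1 hc

/-- Proper separation of a convex set from a disjoint finitely generated cone, by a hyperplane which
does not contain the convex set. -/
theorem exists_proper_separation_cone [DecidableEq V] (n : ℕ) :
    ∀ (G : Finset V), G.card = n → ∀ {U : Set V}, Convex ℝ U → U.Nonempty →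
    (∀ c : V → ℝ, (∀ g ∈ G, 0 ≤ c g) → ∑ g ∈ G, c g • g ∉ U) →
    ∃ l : V →ₗ[ℝ] ℝ, (∀ u ∈ U, l u ≤ 0) ∧ (∀ g ∈ G, 0 ≤ l g) ∧ ∃ u ∈ U, l u < 0 := by
  induction n using Nat.strong_induction_on with
  | _ n ih =>
  intro G hcard U hU hne hdisj
  rcases G.eq_empty_or_nonempty with rfl | ⟨g, hg⟩
  · obtain ⟨l, h1, h2⟩ := exists_proper_separation_zero hU hne (by simpa using hdisj 0)
    exact ⟨l, h1, by simp, h2⟩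
  have hlt : (G.erase g).card < n := by
    rw [← hcard]; exact Finset.card_erase_lt_of_mem hg
  -- One generator is traded for a larger convex set. A functional separating `U'` has the right
  -- sign on `U` by small `r`, and at `g` by large `r`.
  set U' : Set V := {v | ∃ u ∈ U, ∃ r : ℝ, 0 < r ∧ v = u - r • g} with hU'
  have hU'c : Convex ℝ U' := by
    rintro _ ⟨u, hu, r, hr, rfl⟩ _ ⟨v, hv, s, hs, rfl⟩ a b ha hb hab
    refine ⟨a • u + b • v, hU hu hv ha hb hab, a * r + b * s, ?_, ?_⟩
    · rcases ha.eq_or_lt with rfl | ha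
      · have : b = 1 := by linarith
        subst this; simpa using hs
      · positivity
    · module
  have hU'ne : U'.Nonempty := hne.elim fun u hu => ⟨_, u, hu, 1, one_pos, rfl⟩
  have hU'disj : ∀ c : V → ℝ, (∀ h ∈ G.erase g, 0 ≤ c h) → ∑ h ∈ G.erase g, c h • h ∉ U' := by
    rintro c hc ⟨u, hu, r, hr, he⟩
    refine hdisj (Function.update c g r) ?_ ?_
    · intro h hh
      by_cases hgh : h = g
      · subst hgh; simpa using hr.le
      · simpa [Function.update_of_ne hgh] using hc h (Finset.mem_erase.2 ⟨hgh, hh⟩)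
    · rw [← Finset.add_sum_erase _ _ hg]
      have : ∑ x ∈ G.erase g, Function.update c g r x • x = ∑ h ∈ G.erase g, c h • h :=
        Finset.sum_congr rfl fun x hx => by
          rw [Function.update_of_ne (Finset.ne_of_mem_erase hx)]
      rw [this, he, Function.update_self]
      simpa using hu
  obtain ⟨l, hl1, hl2, hl3⟩ := ih _ hlt (G.erase g) rfl hU'c hU'ne hU'disj
  have hbd : ∀ u ∈ U, ∀ r : ℝ, 0 < r → l u ≤ r * l g := by
    intro u hu r hr
    have := hl1 _ ⟨u, hu, r, hr, rfl⟩
    simp only [map_sub, map_smul, smul_eq_mul] at this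
    linarith
  have hlg : 0 ≤ l g := by
    by_contra! hneg
    obtain ⟨u, hu⟩ := hne
    have hr : 0 < (|l u| + 1) / (-l g) := by
      have : 0 < -l g := by linarith
      positivity
    have h1 := hbd u hu _ hr
    have h2 : (|l u| + 1) / (-l g) * l g = -(|l u| + 1) := by
      have : l g ≠ 0 := hneg.ne
      field_simp
    rw [h2] at h1
    linarith [neg_abs_le (l u)]
  have hlU : ∀ u ∈ U, l u ≤ 0 := by
    intro u hu
    refine le_of_forall_pos_le_add fun ε hε => ?_
    have h1 := hbd u hu (ε / (l g + 1)) (by positivity)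
    have h2 : ε / (l g + 1) * l g ≤ ε := by
      rw [div_mul_eq_mul_div, div_le_iff₀ (by positivity)]
      nlinarith
    linarith
  have hlG : ∀ h ∈ G, 0 ≤ l h := by
    intro h hh
    by_cases hgh : h = g
    · exact hgh ▸ hlg
    · exact hl2 h (Finset.mem_erase.2 ⟨hgh, hh⟩)
  by_cases hstrict : ∃ u ∈ U, l u < 0
  · exact ⟨l, hlU, hlG, hstrict⟩
  -- The remaining case is `l = 0` on `U`, where strictness on `U'` forces `l g > 0`. Separating
  -- from the generators in the kernel of `l`, which are strictly fewer, gives `k`. Adding a large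
  -- multiple of `l` repairs the sign of `k` on the other generators and changes nothing on `U`.
  push Not at hstrict
  have hzero : ∀ u ∈ U, l u = 0 := fun u hu => le_antisymm (hlU u hu) (hstrict u hu)
  have hlgpos : 0 < l g := by
    obtain ⟨_, ⟨u, hu, r, hr, rfl⟩, hlt⟩ := hl3
    simp only [map_sub, map_smul, smul_eq_mul, hzero u hu] at hlt
    have : 0 < r * l g := by linarith
    exact (pos_iff_pos_of_mul_pos this).1 hr
  set G0 := G.filter (fun h => l h = 0) with hG0
  have hG0lt : G0.card < n := by
    rw [← hcard]
    refine Finset.card_lt_card (Finset.filter_ssubset.2 ⟨g, hg, hlgpos.ne'⟩)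
  have hdisj0 : ∀ c : V → ℝ, (∀ h ∈ G0, 0 ≤ c h) → ∑ h ∈ G0, c h • h ∉ U := by
    intro c hc hmem
    refine hdisj (fun h => if l h = 0 then c h else 0) ?_ ?_
    · intro h hh
      split_ifs with h0
      · exact hc h (Finset.mem_filter.2 ⟨hh, h0⟩)
      · exact le_rfl
    · simpa [hG0, Finset.sum_filter, ite_smul] using hmem
  obtain ⟨k, hk1, hk2, hk3⟩ := ih _ hG0lt G0 rfl hU hne hdisj0
  obtain ⟨M, hM⟩ : ∃ M : ℝ, ∀ h ∈ G, 0 ≤ k h + M * l h := by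
    have hone : ∀ h ∈ G, 0 ≤ |k h| / l h := fun h hh => div_nonneg (abs_nonneg _) (hlG h hh)
    refine ⟨∑ h ∈ G, |k h| / l h, fun h hh => ?_⟩
    rcases (hlG h hh).eq_or_lt with h0 | hpos
    · rw [← h0, mul_zero, add_zero]
      exact hk2 h (Finset.mem_filter.2 ⟨hh, h0.symm⟩)
    · have h1 : |k h| / l h ≤ ∑ h ∈ G, |k h| / l h := Finset.single_le_sum hone hh
      have h2 : |k h| ≤ (∑ h ∈ G, |k h| / l h) * l h := (div_le_iff₀ hpos).1 h1
      linarith [neg_abs_le (k h)]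
  refine ⟨k + M • l, fun u hu => ?_, fun h hh => ?_, ?_⟩
  · simpa [hzero u hu] using hk1 u hu
  · simpa using hM h hh
  · obtain ⟨u, hu, hlt⟩ := hk3
    exact ⟨u, hu, by simpa [hzero u hu] using hlt⟩

/-- A weak affine inequality passes from the relative interior to the convex set. -/
theorem le_of_forall_mem_intrinsicInterior {C : Set V} (hC : Convex ℝ C) (l : V →ₗ[ℝ] ℝ) (r : ℝ)
    (h : ∀ x ∈ intrinsicInterior ℝ C, l x ≤ r) {y : V} (hy : y ∈ C) : l y ≤ r := by
  obtain ⟨x, hx⟩ := Set.Nonempty.intrinsicInterior hC ⟨y, hy⟩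
  have hlim : Filter.Tendsto (fun a : ℝ => a * l x + (1 - a) * l y) (nhdsWithin 0 (Ioi 0))
      (nhds (l y)) := by
    have : Continuous fun a : ℝ => a * l x + (1 - a) * l y := by fun_prop
    simpa using (this.tendsto 0).mono_left nhdsWithin_le_nhds
  refine le_of_tendsto hlim ?_
  have h1 : Ioo (0 : ℝ) 1 ∈ nhdsWithin (0 : ℝ) (Ioi 0) := Ioo_mem_nhdsGT one_pos
  filter_upwards [h1] with a ha
  have := h _ (combo_mem_intrinsicInterior hC hx hy ha.1 (by linarith [ha.2] : 0 ≤ 1 - a) (by ring))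
  simpa using this

/-- Proper separation of a point shifted by a finitely generated cone from the relative interior of a
convex hull. -/
theorem exists_proper_separation_convexHull {K : Set V} (hK : K.Nonempty) (G : Finset V) (p : V)
    (h : ∀ c : V → ℝ, (∀ g ∈ G, 0 ≤ c g) →
      p + ∑ g ∈ G, c g • g ∉ intrinsicInterior ℝ (convexHull ℝ K)) :
    ∃ l : V →ₗ[ℝ] ℝ, (∀ z ∈ K, l z ≤ l p) ∧ (∀ g ∈ G, 0 ≤ l g) ∧ ∃ z ∈ K, l z ≠ l p := by
  classical
  have hconv := convex_convexHull ℝ K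
  set R := intrinsicInterior ℝ (convexHull ℝ K) with hR
  have hRc : Convex ℝ ((fun v => p + v) ⁻¹' R) :=
    (convex_intrinsicInterior hconv).translate_preimage_right p
  have hRne : ((fun v => p + v) ⁻¹' R).Nonempty := by
    obtain ⟨x, hx⟩ := Set.Nonempty.intrinsicInterior hconv hK.convexHull
    exact ⟨x - p, by rwa [mem_preimage, add_sub_cancel]⟩
  obtain ⟨l, hl1, hl2, u, hu, hlu⟩ :=
    exists_proper_separation_cone G.card G rfl hRc hRne fun c hc hmem => h c hc hmem
  refine ⟨l, fun z hz => ?_, hl2, ?_⟩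
  · refine le_of_forall_mem_intrinsicInterior hconv l (l p) (fun x hx => ?_)
      (subset_convexHull ℝ K hz)
    have := hl1 (x - p) (by rwa [mem_preimage, add_sub_cancel])
    rw [map_sub] at this
    linarith
  · by_contra! hall
    have hsub : convexHull ℝ K ⊆ {x | l x = l p} :=
      convexHull_min hall ((convex_singleton (l p)).linear_preimage l)
    have : l (p + u) = l p := hsub (intrinsicInterior_subset hu)
    rw [map_add] at this
    linarith

end Separation

/-! ### One-period duality for a fixed outcome set. -/

section OneStep

variable {d : ℕ}

local notation "E" => EuclideanSpace ℝ (Fin d)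

/-- The values `y` for which `(s, y)` lies in the relative interior of the convex hull of `K`, minus
the polar cone of `A`. -/
def reachableValues (K : Set (E × ℝ)) (A : Set E) (s : E) : Set ℝ :=
  {y | (s, y) ∈ intrinsicInterior ℝ (convexHull ℝ K) - polarCone A ×ˢ ({0} : Set ℝ)}

/-- The portfolios in `A` whose one-step gain from the initial capital `x` dominates `h` on `K`. -/
def hedgeSet (h : E × ℝ → ℝ) (K : Set (E × ℝ)) (A : Set E) (s : E) (x : ℝ) : Set E :=
  {γ | γ ∈ A ∧ ∀ z ∈ K, h z ≤ x + inner ℝ γ (z.1 - s)}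

/-- There is no one-step arbitrage from `s` with portfolios in `A` and outcomes in `K`. -/
def NoOneStepArbitrage (K : Set (E × ℝ)) (A : Set E) (s : E) : Prop :=
  ∀ γ ∈ hedgeSet 0 K A s 0, ∀ z ∈ K, inner ℝ γ (z.1 - s) = 0

theorem sum_mem_polarCone {ι : Type*} {A : Set E} (G : Finset ι) (c : ι → ℝ) (v : ι → E)
    (hc : ∀ g ∈ G, 0 ≤ c g) (hv : ∀ g ∈ G, v g ∈ polarCone A) :
    ∑ g ∈ G, c g • v g ∈ polarCone A := by
  intro x hx
  rw [inner_sum]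
  refine Finset.sum_nonpos fun g hg => ?_
  rw [inner_smul_right]
  exact mul_nonpos_of_nonneg_of_nonpos (hc g hg) (hv g hg x hx)

theorem exists_inner_add_mul_eq (l : E × ℝ →ₗ[ℝ] ℝ) :
    ∃ (g : E) (α : ℝ), ∀ z : E × ℝ, l z = inner ℝ g z.1 + α * z.2 := by
  refine ⟨(InnerProductSpace.toDual ℝ E).symm
    (LinearMap.toContinuousLinearMap (l ∘ₗ LinearMap.inl ℝ E ℝ)), l (0, 1), fun z => ?_⟩
  rw [InnerProductSpace.toDual_symm_apply]
  have h1 : z = (z.1, 0) + z.2 • ((0 : E), (1 : ℝ)) := by ext <;> simp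
  conv_lhs => rw [h1, map_add, map_smul]
  simp [mul_comm]

/-- The functional obtained by separating `(s, r)` from the relative interior of the convex hull of
`K` along the polar cone of `A` is not vertical. -/
theorem exists_separating_portfolio {K : Set (E × ℝ)} (hK : K.Nonempty) {A : Set E}
    (hA : IsPolyhedralCone A) {s : E} (hNA : NoOneStepArbitrage K A s) (r : ℝ) (P : Finset ℝ)
    (W : PointedCone ℝ ℝ) (hPW : ∀ a ∈ P, a ∈ W) (hW : ∀ w ∈ W, r + w ∉ reachableValues K A s) :
    ∃ (g : E) (α : ℝ), α ≠ 0 ∧ -g ∈ A ∧ (∀ a ∈ P, 0 ≤ α * a) ∧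
      ∀ z ∈ K, inner ℝ g z.1 + α * z.2 ≤ inner ℝ g s + α * r := by
  classical
  obtain ⟨t, ht⟩ := hA
  have h0 : (0 : E) ∈ polarCone A := fun x _ => by simp
  -- The normals of `A` lie in its polar cone, and nonnegativity of the functional on them puts `-g`
  -- in `A`. The vertical generators from `P` control the sign of `α`.
  set G : Finset (E × ℝ) := t.image (fun a => (a, 0)) ∪ P.image (fun a => (0, a)) with hG
  have hG1 : ∀ g ∈ G, g.1 ∈ polarCone A := by
    intro g hg
    rcases Finset.mem_union.1 hg with hg | hg <;> obtain ⟨a, ha, rfl⟩ := Finset.mem_image.1 hg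
    · intro x hx
      rw [ht] at hx
      rw [real_inner_comm]
      exact hx a ha
    · exact h0
  have hG2 : ∀ g ∈ G, g.2 ∈ W := by
    intro g hg
    rcases Finset.mem_union.1 hg with hg | hg <;> obtain ⟨a, ha, rfl⟩ := Finset.mem_image.1 hg
    · exact W.zero_mem
    · exact hPW a ha
  obtain ⟨l, hl1, hl2, hl3⟩ := exists_proper_separation_convexHull hK G (s, r) (by
    intro c hc hmem
    have hw : ∑ g ∈ G, c g * g.2 ∈ W :=
      W.sum_mem fun g hg => W.smul_mem (hc g hg) (hG2 g hg)
    refine hW _ hw (Set.mem_sub.2 ⟨_, hmem, (∑ g ∈ G, c g • g.1, 0),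
      ⟨sum_mem_polarCone G c _ hc hG1, rfl⟩, ?_⟩)
    ext1
    · simp [Prod.fst_sum]
    · simp [Prod.snd_sum])
  obtain ⟨g, α, hgα⟩ := exists_inner_add_mul_eq l
  have hgA : -g ∈ A := by
    rw [ht]
    intro a ha
    have := hl2 (a, 0) (Finset.mem_union_left _ (Finset.mem_image_of_mem _ ha))
    rw [hgα] at this
    simpa [real_inner_comm] using this
  refine ⟨g, α, ?_, hgA, fun a ha => ?_, fun z hz => ?_⟩
  -- If `α = 0`, then `-g` has nonnegative gain on `K`, hence zero gain, so the hyperplane contains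
  -- `K`, against properness.
  · rintro rfl
    obtain ⟨z, hz, hne⟩ := hl3
    have h1 : -g ∈ hedgeSet 0 K A s 0 := by
      refine ⟨hgA, fun z hz => ?_⟩
      have := hl1 z hz
      simp only [hgα] at this
      simp only [Pi.zero_apply, inner_neg_left, inner_sub_right]
      linarith
    have h2 := hNA _ h1 z hz
    simp only [hgα] at hne
    simp only [inner_neg_left, inner_sub_right] at h2
    exact hne (by linarith)
  · have := hl2 (0, a) (Finset.mem_union_right _ (Finset.mem_image_of_mem _ ha))
    simpa [hgα] using this
  · simpa only [hgα] using hl1 z hz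

theorem reachableValues_nonempty {K : Set (E × ℝ)} (hK : K.Nonempty) {A : Set E}
    (hA : IsPolyhedralCone A) {s : E} (hNA : NoOneStepArbitrage K A s) :
    (reachableValues K A s).Nonempty := by
  by_contra hempty
  -- If nothing is reachable, the whole vertical line is separated; this forces `α = 0`.
  obtain ⟨g, α, hα, -, hP, -⟩ := exists_separating_portfolio hK hA hNA 0 {1, -1} ⊤
    (fun _ _ => trivial) fun w _ hw => hempty ⟨_, hw⟩
  have h1 := hP 1 (by simp)
  have h2 := hP (-1) (by simp)
  exact hα (by linarith)

theorem hedgeSet_nonempty_of_lt {K : Set (E × ℝ)} (hK : K.Nonempty) {A : Set E}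
    (hA : IsPolyhedralCone A) {s : E} (hNA : NoOneStepArbitrage K A s) {b x : ℝ}
    (hb : b ∈ upperBounds (reachableValues K A s)) (hbx : b < x) :
    (hedgeSet Prod.snd K A s x).Nonempty := by
  -- Only the upward ray is used here, which makes `α` positive; the hedge is then `-g / α`.
  obtain ⟨g, α, hα, hgA, hP, hle⟩ := exists_separating_portfolio hK hA hNA x {1}
    (PointedCone.positive ℝ ℝ) (by simp) (by
      intro w hw hmem
      have h1 : 0 ≤ w := hw
      have h2 := hb hmem
      linarith)
  have hαpos : 0 < α := lt_of_le_of_ne (by simpa using hP 1 (by simp)) hα.symm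
  refine ⟨α⁻¹ • -g, ?_, fun z hz => ?_⟩
  · obtain ⟨t, rfl⟩ := hA
    intro a ha
    rw [inner_smul_right]
    exact mul_nonpos_of_nonneg_of_nonpos (inv_pos.2 hαpos).le (hgA a ha)
  · have h1 := hle z hz
    have h2 : α * z.2 ≤ α * x + inner ℝ (-g) (z.1 - s) := by
      simp only [inner_neg_left, inner_sub_right]
      linarith
    rw [inner_smul_left, RCLike.conj_to_real, ← div_eq_inv_mul]
    have h3 : α * (x + inner ℝ (-g) (z.1 - s) / α) = α * x + inner ℝ (-g) (z.1 - s) := by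
      field_simp
    exact le_of_mul_le_mul_left (h3 ▸ h2) hαpos

theorem le_of_mem_reachableValues {K : Set (E × ℝ)} {A : Set E} {s γ : E} {x y : ℝ}
    (hγ : γ ∈ hedgeSet Prod.snd K A s x) (hy : y ∈ reachableValues K A s) : y ≤ x := by
  obtain ⟨z, hz, ⟨b, r⟩, ⟨hb, hr⟩, hzb⟩ := Set.mem_sub.1 hy
  obtain rfl : r = 0 := hr
  have hconv : Convex ℝ {z : E × ℝ | z.2 ≤ x + inner ℝ γ (z.1 - s)} := by
    intro u hu v hv a c ha hc hac
    simp only [mem_ofPred_eq, Prod.snd_add, Prod.smul_snd, smul_eq_mul, Prod.fst_add, Prod.smul_fst,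
      inner_sub_right, inner_add_right, inner_smul_right] at hu hv ⊢
    have e : x - inner ℝ γ s = a * (x - inner ℝ γ s) + c * (x - inner ℝ γ s) := by
      rw [← add_mul, hac, one_mul]
    linarith [mul_le_mul_of_nonneg_left hu ha, mul_le_mul_of_nonneg_left hv hc]
  have h1 : z.2 ≤ x + inner ℝ γ (z.1 - s) :=
    convexHull_min hγ.2 hconv (intrinsicInterior_subset hz)
  have h2 : z.1 - s = b := by
    have := congrArg Prod.fst hzb
    simp only [Prod.fst_sub] at this
    rw [← this, sub_sub_cancel]
  have h3 : z.2 = y := by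
    have := congrArg Prod.snd hzb
    simpa using this
  have h4 := hb γ hγ.1
  rw [h2, h3] at h1
  linarith

end OneStep

/-! ### Measurable set-valued maps and their selections. -/

section Measurability

variable {d : ℕ}

local notation "E" => EuclideanSpace ℝ (Fin d)

/-- The obtuse-angle property of projections gives the second bound: almost minimising points are
close to the minimiser, so minimising sequences converge to it. -/
theorem exists_closest_point {A : Set E} (hne : A.Nonempty) (hcl : IsClosed A) (hcv : Convex ℝ A)
    (q : E) : ∃ v ∈ A, ∀ a ∈ A, ‖q - v‖ ≤ ‖q - a‖ ∧ ‖a - v‖ ^ 2 ≤ ‖q - a‖ ^ 2 - ‖q - v‖ ^ 2 := by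
  obtain ⟨v, hv, hmin⟩ := exists_norm_eq_iInf_of_complete_convex hne hcl.isComplete hcv q
  have hinner := (norm_eq_iInf_iff_real_inner_le_zero hcv hv).1 hmin
  refine ⟨v, hv, fun a ha => ?_⟩
  have h1 : ‖q - a‖ ^ 2 = ‖q - v‖ ^ 2 - 2 * inner ℝ (q - v) (a - v) + ‖a - v‖ ^ 2 := by
    rw [← norm_sub_sq_real]
    congr 2
    abel
  have h2 : ‖a - v‖ ^ 2 ≤ ‖q - a‖ ^ 2 - ‖q - v‖ ^ 2 := by linarith [hinner a ha]
  exact ⟨le_of_sq_le_sq (by nlinarith [sq_nonneg ‖a - v‖]) (norm_nonneg _), h2⟩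

/-- The closest point to `q` in a measurable closed convex set-valued map is a measurable
selection. -/
theorem exists_measurable_closest_point {Ω : Type*} [m : MeasurableSpace Ω] {A : Ω → Set E}
    (hA : IsMeasurableSetValued m A) (hcl : ∀ ω, IsClosed (A ω)) (hcv : ∀ ω, Convex ℝ (A ω))
    (q : E) : ∃ γ : Ω → E, Measurable γ ∧ ∀ ω, (A ω).Nonempty →
      γ ω ∈ A ω ∧ ∀ a ∈ A ω, ‖q - γ ω‖ ≤ ‖q - a‖ := by
  -- Empty values are replaced by the whole space, which preserves measurability.
  wlog hne : ∀ ω, (A ω).Nonempty generalizing A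
  · classical
    have hN : MeasurableSet {ω | (A ω).Nonempty} := by simpa using hA univ isOpen_univ
    obtain ⟨γ, hγ, h⟩ := this (A := fun ω => if (A ω).Nonempty then A ω else univ) (by
        intro U hU
        have : {ω | ((if (A ω).Nonempty then A ω else univ) ∩ U).Nonempty}
            = {ω | (A ω ∩ U).Nonempty} ∪ ({ω | (A ω).Nonempty}ᶜ ∩ {_ω | U.Nonempty}) := by
          ext ω
          by_cases h : (A ω).Nonempty
          · simp [h]
          · simp [not_nonempty_iff_eq_empty.1 h]
        rw [this]
        exact (hA U hU).union (hN.compl.inter (MeasurableSet.const _)))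
      (fun ω => by split_ifs; exacts [hcl ω, isClosed_univ])
      (fun ω => by split_ifs; exacts [hcv ω, convex_univ])
      (fun ω => by split_ifs with h; exacts [h, univ_nonempty])
    refine ⟨γ, hγ, fun ω hω => ?_⟩
    have := h ω
    rw [if_pos hω] at this
    exact this hω
  choose γ hγA hγ using fun ω => exists_closest_point (hne ω) (hcl ω) (hcv ω) q
  refine ⟨γ, ?_, fun ω _ => ⟨hγA ω, fun a ha => (hγ ω a ha).1⟩⟩
  have hδ : Measurable fun ω => ‖q - γ ω‖ := by
    refine measurable_of_Iio fun r => ?_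
    have : (fun ω => ‖q - γ ω‖) ⁻¹' Iio r = {ω | (A ω ∩ {a | ‖q - a‖ < r}).Nonempty} := by
      ext ω
      exact ⟨fun h => ⟨γ ω, hγA ω, h⟩, fun ⟨a, ha, har⟩ => ((hγ ω a ha).1).trans_lt har⟩
    rw [this]
    exact hA _ (isOpen_lt (by fun_prop) continuous_const)
  refine measurable_of_isClosed fun C hC => ?_
  -- The nearest point lies in the closed set `C` exactly when, at every scale, some almost
  -- minimising point lies near `C`. The rational `r` makes the test set open and independent of
  -- `ω`.
  have : γ ⁻¹' C = ⋂ n : ℕ, ⋃ r : ℚ, {ω | (r : ℝ) < ‖q - γ ω‖ + 1 / (n + 1)} ∩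
      {ω | (A ω ∩ ({a | ‖q - a‖ < r} ∩ Metric.thickening (1 / (n + 1)) C)).Nonempty} := by
    ext ω
    simp only [mem_preimage, mem_iInter, mem_iUnion, mem_inter_iff, mem_ofPred_eq]
    constructor
    · intro hω n
      have hn : (0 : ℝ) < 1 / (n + 1) := by positivity
      obtain ⟨r, hr1, hr2⟩ := exists_rat_btwn (lt_add_of_pos_right ‖q - γ ω‖ hn)
      exact ⟨r, hr2, γ ω, hγA ω, hr1, Metric.self_subset_thickening hn C hω⟩
    · intro h
      choose r hr a haA har haC using h
      have hlim0 : Filter.Tendsto (fun n : ℕ => (1 : ℝ) / (n + 1)) Filter.atTop (nhds 0) :=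
        tendsto_one_div_add_atTop_nhds_zero_nat
      have hlim : Filter.Tendsto a Filter.atTop (nhds (γ ω)) := by
        rw [tendsto_iff_norm_sub_tendsto_zero]
        have hsq : Filter.Tendsto (fun n : ℕ => √((‖q - γ ω‖ + 1 / (n + 1)) ^ 2 - ‖q - γ ω‖ ^ 2))
            Filter.atTop (nhds 0) := by
          have h1 := (((hlim0.const_add ‖q - γ ω‖).pow 2).sub_const (‖q - γ ω‖ ^ 2)).sqrt
          simpa using h1
        refine squeeze_zero (fun _ => norm_nonneg _) (fun n => ?_) hsq
        refine Real.le_sqrt_of_sq_le (((hγ ω _ (haA n)).2).trans ?_)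
        have h2 : ‖q - a n‖ ≤ ‖q - γ ω‖ + 1 / (n + 1) := ((har n).trans (hr n)).le
        gcongr
      choose c hcC hc using fun n => Metric.mem_thickening_iff.1 (haC n)
      have hlimc : Filter.Tendsto c Filter.atTop (nhds (γ ω)) := by
        refine hlim.congr_dist ?_
        exact squeeze_zero (fun _ => dist_nonneg) (fun n => (hc n).le) hlim0
      exact hC.mem_of_tendsto hlimc (Filter.Eventually.of_forall hcC)
  rw [this]
  refine MeasurableSet.iInter fun n => MeasurableSet.iUnion fun r => ?_
  exact (measurableSet_lt measurable_const (hδ.add_const _)).inter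
    (hA _ ((isOpen_lt (by fun_prop) continuous_const).inter Metric.isOpen_thickening))

/-- An open set is a countable union of closed balls. Testing on closed balls makes compactness
available for the hedge sets. -/
theorem isMeasurableSetValued_of_closedBall {Ω : Type*} [m : MeasurableSpace Ω] {A : Ω → Set E}
    (h : ∀ (q : E) (r : ℝ), MeasurableSet {ω | (A ω ∩ Metric.closedBall q r).Nonempty}) :
    IsMeasurableSetValued m A := by
  intro U hU
  have : {ω | (A ω ∩ U).Nonempty} = ⋃ k : ℕ, ⋃ j : ℕ,
      ⋃ _ : Metric.closedBall (TopologicalSpace.denseSeq E k) (1 / (j + 1)) ⊆ U,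
        {ω | (A ω ∩ Metric.closedBall (TopologicalSpace.denseSeq E k) (1 / (j + 1))).Nonempty} := by
    ext ω
    simp only [mem_iUnion, mem_ofPred_eq, exists_prop]
    constructor
    · rintro ⟨a, ha, haU⟩
      obtain ⟨ε, hε, hball⟩ := Metric.isOpen_iff.1 hU a haU
      obtain ⟨j, hj⟩ := exists_nat_one_div_lt (half_pos hε)
      have hj0 : (0 : ℝ) < 1 / (j + 1) := by positivity
      obtain ⟨k, hk⟩ := (TopologicalSpace.denseRange_denseSeq E).exists_dist_lt a hj0
      refine ⟨k, j, fun b hb => hball ?_, a, ha, hk.le⟩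
      rw [Metric.mem_closedBall] at hb
      rw [Metric.mem_ball]
      rw [dist_comm] at hk
      linarith [dist_triangle b (TopologicalSpace.denseSeq E k) a]
    · rintro ⟨k, j, hsub, a, ha, hab⟩
      exact ⟨a, ha, hsub hab⟩
  rw [this]
  exact MeasurableSet.iUnion fun k => MeasurableSet.iUnion fun j => MeasurableSet.iUnion fun _ =>
    h _ _

/-- The support is conull and is contained in every closed conull set, such as `{φ ≤ 0}`. -/
theorem forall_mem_support_nonpos_iff {X : Type*} [TopologicalSpace X] [MeasurableSpace X]
    [HereditarilyLindelofSpace X] (ν : Measure X) {φ : X → ℝ} (hφ : Continuous φ) :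
    (∀ z ∈ ν.support, φ z ≤ 0) ↔ ∀ᵐ z ∂ν, φ z ≤ 0 :=
  ⟨fun h => Filter.mem_of_superset Measure.support_mem_ae h,
    fun h => Measure.support_subset_of_isClosed (isClosed_le hφ continuous_const) h⟩

theorem isClosed_hedgeSet (h : E × ℝ → ℝ) (K : Set (E × ℝ)) {A : Set E} (hA : IsClosed A) (s : E)
    (x : ℝ) : IsClosed (hedgeSet h K A s x) := by
  have : hedgeSet h K A s x = A ∩ ⋂ z ∈ K, {γ | h z ≤ x + inner ℝ γ (z.1 - s)} := by
    ext γ; simp [hedgeSet]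
  rw [this]
  exact hA.inter (isClosed_biInter fun z _ => isClosed_le continuous_const (by fun_prop))

theorem convex_hedgeSet (h : E × ℝ → ℝ) (K : Set (E × ℝ)) {A : Set E} (hA : Convex ℝ A) (s : E)
    (x : ℝ) : Convex ℝ (hedgeSet h K A s x) := by
  intro u hu v hv a b ha hb hab
  refine ⟨hA hu.1 hv.1 ha hb hab, fun z hz => ?_⟩
  rw [inner_add_left, inner_smul_left, inner_smul_left]
  simp only [RCLike.conj_to_real]
  have e : ∀ y : ℝ, y = a * y + b * y := fun y => by rw [← add_mul, hab, one_mul]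
  linarith [mul_le_mul_of_nonneg_left (hu.2 z hz) ha, mul_le_mul_of_nonneg_left (hv.2 z hz) hb,
    e x, e (h z)]

/-- The hedging portfolios for a random support form a measurable set-valued map. -/
theorem isMeasurableSetValued_hedgeSet {Ω : Type*} [m : MeasurableSpace Ω] {A : Ω → Set E}
    (hA : IsMeasurableSetValued m A) (hcl : ∀ ω, IsClosed (A ω)) (κ : Kernel Ω (E × ℝ))
    [IsMarkovKernel κ] {h : E × ℝ → ℝ} (hh : Continuous h) {s : Ω → E} (hs : Measurable s)
    {x : Ω → ℝ} (hx : Measurable x) :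
    IsMeasurableSetValued m fun ω => hedgeSet h (κ ω).support (A ω) (s ω) (x ω) := by
  refine isMeasurableSetValued_of_closedBall fun q r => ?_
  set ε : ℕ → ℝ := fun n => 1 / (n + 1) with hε
  have hεpos : ∀ n, 0 < ε n := fun n => by simp only [hε]; positivity
  have hεlim : Filter.Tendsto ε Filter.atTop (nhds 0) := tendsto_one_div_add_atTop_nhds_zero_nat
  set u := TopologicalSpace.denseSeq E
  -- By Cauchy-Schwarz, the slack `ε n * ‖z.1 - s‖` pays for replacing a portfolio by a point of the
  -- dense sequence within `ε n`.
  set φ : ℕ → ℕ → Ω × (E × ℝ) → ℝ := fun n k p =>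
    h p.2 - (x p.1 + inner ℝ (u k) (p.2.1 - s p.1) + ε n * ‖p.2.1 - s p.1‖) with hφ
  have hφm : ∀ n k, Measurable (φ n k) := fun n k => by
    have := hh.measurable
    simp only [hφ]
    fun_prop
  have hφc : ∀ n k ω, Continuous fun z => φ n k (ω, z) := fun n k ω => by
    simp only [hφ]
    fun_prop
  have hset : {ω | (hedgeSet h (κ ω).support (A ω) (s ω) (x ω) ∩
      Metric.closedBall q r).Nonempty} = ⋂ n : ℕ, ⋃ k : ℕ, ⋃ _ : dist (u k) q ≤ r + ε n,
        {ω | (A ω ∩ Metric.ball (u k) (ε n)).Nonempty} ∩ {ω | κ ω {z | 0 < φ n k (ω, z)} = 0} := by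
    ext ω
    have hκ : ∀ n k, κ ω {z | 0 < φ n k (ω, z)} = 0 ↔ ∀ z ∈ (κ ω).support, φ n k (ω, z) ≤ 0 := by
      intro n k
      rw [forall_mem_support_nonpos_iff _ (hφc n k ω), ae_iff]
      simp only [not_le]
    simp only [mem_iInter, mem_iUnion, mem_inter_iff, mem_ofPred_eq, exists_prop, hκ]
    constructor
    · rintro ⟨γ, ⟨hγA, hγ⟩, hγq⟩ n
      obtain ⟨k, hk⟩ := (TopologicalSpace.denseRange_denseSeq E).exists_dist_lt γ (hεpos n)
      refine ⟨k, ?_, ⟨γ, hγA, hk⟩, fun z hz => ?_⟩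
      · rw [Metric.mem_closedBall] at hγq
        rw [dist_comm] at hk
        linarith [dist_triangle (u k) γ q]
      · have h1 := hγ z hz
        have h2 : inner ℝ (γ - u k) (z.1 - s ω) ≤ ε n * ‖z.1 - s ω‖ := by
          refine (real_inner_le_norm _ _).trans ?_
          gcongr
          rw [← dist_eq_norm]
          exact hk.le
        rw [inner_sub_left] at h2
        simp only [hφ]
        linarith
    -- The approximating portfolios stay in a fixed compact ball, so a subsequence converges to an
    -- exact hedge in `A ω` as the slack vanishes.
    · intro hall
      choose k hkq hkA hk using hall
      choose a haA ha using hkA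
      have hbdd : ∀ n, u (k n) ∈ Metric.closedBall q (r + 1) := fun n => by
        have : ε n ≤ 1 := by
          simp only [hε]
          rw [div_le_one (by positivity)]
          linarith [(Nat.cast_nonneg n : (0 : ℝ) ≤ n)]
        rw [Metric.mem_closedBall]
        linarith [hkq n]
      obtain ⟨γ, -, ψ, hψ, hlim⟩ := (isCompact_closedBall q (r + 1)).tendsto_subseq hbdd
      have hεψ := hεlim.comp hψ.tendsto_atTop
      refine ⟨γ, ⟨?_, fun z hz => ?_⟩, ?_⟩
      · refine (hcl ω).mem_of_tendsto (f := fun n => a (ψ n)) (b := Filter.atTop) ?_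
          (Filter.Eventually.of_forall fun n => haA _)
        refine hlim.congr_dist (squeeze_zero (fun _ => dist_nonneg) (fun n => ?_) hεψ)
        have := ha (ψ n)
        rw [Metric.mem_ball, dist_comm] at this
        exact this.le
      · have hl : Filter.Tendsto (fun n => x ω + inner ℝ (u (k (ψ n))) (z.1 - s ω) +
            ε (ψ n) * ‖z.1 - s ω‖) Filter.atTop
            (nhds (x ω + inner ℝ γ (z.1 - s ω) + 0 * ‖z.1 - s ω‖)) :=
          (((hlim.inner tendsto_const_nhds).const_add _).add (hεψ.mul_const _))
        rw [zero_mul, add_zero] at hl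
        refine ge_of_tendsto' hl fun n => ?_
        have := hk (ψ n) z hz
        simp only [hφ] at this
        linarith
      · have h1 : Filter.Tendsto (fun n => dist (u (k (ψ n))) q) Filter.atTop
            (nhds (dist γ q)) := hlim.dist tendsto_const_nhds
        have h2 : Filter.Tendsto (fun n => r + ε (ψ n)) Filter.atTop (nhds (r + 0)) :=
          hεψ.const_add r
        rw [add_zero] at h2
        exact le_of_tendsto_of_tendsto' h1 h2 fun n => hkq _
  rw [hset]
  refine MeasurableSet.iInter fun n => MeasurableSet.iUnion fun k => MeasurableSet.iUnion fun _ =>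
    (hA _ Metric.isOpen_ball).inter ?_
  have hms : MeasurableSet {p | 0 < φ n k p} := measurableSet_lt measurable_const (hφm n k)
  exact Kernel.measurable_kernel_prodMk_left hms (measurableSet_singleton 0)

end Measurability

/-! ### Almost sure inequalities and conditional supports. -/

section ConditionalSupport

variable {d : ℕ} {Ω : Type*}

local notation "E" => EuclideanSpace ℝ (Fin d)

/-- The joint law disintegrates into the law of `X` and the conditional distribution of `Y`. -/
theorem ae_condDistrib_iff {β Z : Type*} [MeasurableSpace Ω] [MeasurableSpace β]
    [MeasurableSpace Z] [StandardBorelSpace Z] [Nonempty Z] (μ : Measure Ω) [IsFiniteMeasure μ]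
    {X : Ω → β} {Y : Ω → Z} (hX : Measurable X) (hY : Measurable Y) {p : β × Z → Prop}
    (hp : MeasurableSet {x | p x}) :
    (∀ᵐ ω ∂μ, p (X ω, Y ω)) ↔ ∀ᵐ ω ∂μ, ∀ᵐ z ∂condDistrib Y X μ (X ω), p (X ω, z) := by
  have h1 : MeasurableSet {b | ∀ᵐ z ∂condDistrib Y X μ b, p (b, z)} :=
    Kernel.measurable_kernel_prodMk_left hp.compl (measurableSet_singleton 0)
  rw [← ae_map_iff hX.aemeasurable h1, ← Measure.ae_compProd_iff hp,
    compProd_map_condDistrib hY.aemeasurable, ae_map_iff (hX.prodMk hY).aemeasurable hp]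

/-- A weak inequality holds almost surely if and only if it holds almost surely on the whole
conditional support. -/
theorem ae_nonpos_iff_forall_condSupport {m mΩ : MeasurableSpace Ω} (hm : m ≤ mΩ) (μ : Measure Ω)
    [IsFiniteMeasure μ] {η : Ω → E × ℝ} (hη : Measurable η) {g : Ω → E × ℝ → ℝ}
    (hg : MeasurableSet[m.prod inferInstance] {p : Ω × (E × ℝ) | g p.1 p.2 ≤ 0})
    (hgc : ∀ ω, Continuous (g ω)) :
    (∀ᵐ ω ∂μ, g ω (η ω) ≤ 0) ↔ ∀ᵐ ω ∂μ, ∀ z ∈ condSupport μ m η ω, g ω z ≤ 0 := by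
  have hid : @Measurable Ω Ω mΩ m id := measurable_id'' hm
  have h := @ae_condDistrib_iff Ω Ω (E × ℝ) mΩ m _ _ _ μ _ id η hid hη
    (fun p => g p.1 p.2 ≤ 0) hg
  refine h.trans ?_
  simp only [condSupport, forall_mem_support_nonpos_iff _ (hgc _), id]

theorem measurableSet_hedge [m : MeasurableSpace Ω] {h : E × ℝ → ℝ} (hh : Continuous h)
    {γ s : Ω → E} (hγ : Measurable γ) (hs : Measurable s) {x : Ω → ℝ} (hx : Measurable x) :
    MeasurableSet {p : Ω × (E × ℝ) | h p.2 - (x p.1 + inner ℝ (γ p.1) (p.2.1 - s p.1)) ≤ 0} := by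
  have := hh.measurable
  refine measurableSet_le ?_ measurable_const
  fun_prop

/-- A portfolio hedges almost surely if and only if it hedges on the conditional support. -/
theorem ae_hedge_iff {m mΩ : MeasurableSpace Ω} (hm : m ≤ mΩ) (μ : Measure Ω)
    [IsFiniteMeasure μ] {η : Ω → E × ℝ} (hη : Measurable η) {h : E × ℝ → ℝ} (hh : Continuous h)
    {γ s : Ω → E} (hγ : Measurable[m] γ) (hs : Measurable[m] s) {x : Ω → ℝ}
    (hx : Measurable[m] x) :
    (∀ᵐ ω ∂μ, h (η ω) ≤ x ω + inner ℝ (γ ω) ((η ω).1 - s ω)) ↔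
      ∀ᵐ ω ∂μ, ∀ z ∈ condSupport μ m η ω, h z ≤ x ω + inner ℝ (γ ω) (z.1 - s ω) := by
  simpa only [sub_nonpos] using ae_nonpos_iff_forall_condSupport hm μ hη
    (g := fun ω z => h z - (x ω + inner ℝ (γ ω) (z.1 - s ω)))
    (measurableSet_hedge (m := m) hh hγ hs hx) fun ω => by fun_prop

end ConditionalSupport

/-! ### The one-period problem with random data. -/

section ConditionalStep

variable {d : ℕ} {Ω : Type*}

local notation "E" => EuclideanSpace ℝ (Fin d)

theorem IsPolyhedralCone.isClosed {A : Set E} (hA : IsPolyhedralCone A) : IsClosed A := by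
  obtain ⟨t, rfl⟩ := hA
  have : {x : E | ∀ a ∈ t, inner ℝ a x ≤ 0} = ⋂ a ∈ t, {x | inner ℝ a x ≤ 0} := by ext; simp
  rw [this]
  exact isClosed_biInter fun a _ => isClosed_le (by fun_prop) continuous_const

theorem IsPolyhedralCone.convex {A : Set E} (hA : IsPolyhedralCone A) : Convex ℝ A := by
  obtain ⟨t, rfl⟩ := hA
  intro x hx y hy a b ha hb _ c hc
  rw [inner_add_right, inner_smul_right, inner_smul_right]
  linarith [mul_nonpos_of_nonneg_of_nonpos ha (hx c hc),
    mul_nonpos_of_nonneg_of_nonpos hb (hy c hc)]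

theorem IsPolyhedralCone.zero_mem {A : Set E} (hA : IsPolyhedralCone A) : (0 : E) ∈ A := by
  obtain ⟨t, rfl⟩ := hA
  intro c _
  simp

variable {m mΩ : MeasurableSpace Ω} {μ : Measure Ω} [IsFiniteMeasure μ]
  {η : Ω → EuclideanSpace ℝ (Fin d) × ℝ} {A : Ω → Set (EuclideanSpace ℝ (Fin d))}
  {s : Ω → EuclideanSpace ℝ (Fin d)}

theorem condSupport_nonempty (ω : Ω) : (condSupport μ m η ω).Nonempty :=
  Filter.nonempty_of_mem (Measure.support_mem_ae
    (μ := @condDistrib Ω Ω (E × ℝ) _ _ _ mΩ m η id μ _ ω))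

theorem isMeasurableSetValued_condHedgeSet (hA : IsMeasurableSetValued m A)
    (hpoly : ∀ ω, IsPolyhedralCone (A ω)) {h : E × ℝ → ℝ} (hh : Continuous h)
    (hs : Measurable[m] s) {x : Ω → ℝ} (hx : Measurable[m] x) :
    IsMeasurableSetValued m fun ω => hedgeSet h (condSupport μ m η ω) (A ω) (s ω) (x ω) :=
  @isMeasurableSetValued_hedgeSet d Ω m A hA (fun ω => (hpoly ω).isClosed)
    (@condDistrib Ω Ω (E × ℝ) _ _ _ mΩ m η id μ _) _ h hh s hs x hx

/-- If no admissible random portfolio is an arbitrage, then almost surely there is no arbitrage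
against the conditional support. -/
theorem ae_noOneStepArbitrage (hm : m ≤ mΩ) (hη : Measurable η) (hA : IsMeasurableSetValued m A)
    (hpoly : ∀ ω, IsPolyhedralCone (A ω)) (hs : Measurable[m] s)
    (hNA : ∀ γ : Ω → E, Measurable[m] γ → (∀ ω, γ ω ∈ A ω) →
      (∀ᵐ ω ∂μ, 0 ≤ inner ℝ (γ ω) ((η ω).1 - s ω)) →
      ∀ᵐ ω ∂μ, inner ℝ (γ ω) ((η ω).1 - s ω) = 0) :
    ∀ᵐ ω ∂μ, NoOneStepArbitrage (condSupport μ m η ω) (A ω) (s ω) := by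
  have h0 : Continuous (0 : E × ℝ → ℝ) := continuous_const
  have hx : Measurable[m] fun _ : Ω => (0 : ℝ) := @measurable_const _ _ _ m _
  have hR := isMeasurableSetValued_condHedgeSet (μ := μ) (η := η) hA hpoly h0 hs hx
  have hRne : ∀ ω, (hedgeSet 0 (condSupport μ m η ω) (A ω) (s ω) 0).Nonempty := fun ω =>
    ⟨0, (hpoly ω).zero_mem, fun z _ => by simp⟩
  choose γ hγm hγ using fun q => @exists_measurable_closest_point d Ω m _ hR
    (fun ω => isClosed_hedgeSet _ _ (hpoly ω).isClosed _ _)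
    (fun ω => convex_hedgeSet _ _ (hpoly ω).convex _ _) q
  have hzero : ∀ q, ∀ᵐ ω ∂μ, ∀ z ∈ condSupport μ m η ω, inner ℝ (γ q ω) (z.1 - s ω) = 0 := by
    intro q
    have hmem : ∀ ω, γ q ω ∈ hedgeSet 0 (condSupport μ m η ω) (A ω) (s ω) 0 :=
      fun ω => (hγ q ω (hRne ω)).1
    have h1 := (ae_hedge_iff hm μ hη h0 (hγm q) hs hx).2
      (Filter.Eventually.of_forall fun ω => (hmem ω).2)
    have h2 := hNA (γ q) (hγm q) (fun ω => (hmem ω).1) (by simpa using h1)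
    -- The reverse inequality is transferred through `-γ`; `ae_hedge_iff` involves no constraint, so
    -- `-γ` may leave `A`.
    have h3 := (ae_hedge_iff hm μ hη h0 (hγm q).neg hs hx).1 (by
      filter_upwards [h2] with ω hω
      simp [hω])
    filter_upwards [h3] with ω hω z hz
    have h4 := hω z hz
    have h5 := (hmem ω).2 z hz
    simp only [Pi.zero_apply, Pi.neg_apply, inner_neg_left, zero_add] at h4 h5
    linarith
  -- Nearest points to a dense sequence are dense in the hedge set, so countably many null sets
  -- suffice and zero gain extends to all of it.
  have hall := ae_all_iff.2 fun k => hzero (TopologicalSpace.denseSeq E k)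
  filter_upwards [hall] with ω hω δ hδ z hz
  have hcl : IsClosed {v : E | inner ℝ v (z.1 - s ω) = 0} :=
    isClosed_eq (by fun_prop) continuous_const
  refine hcl.closure_subset (Metric.mem_closure_iff.2 fun ε hε => ?_)
  obtain ⟨k, hk⟩ := (TopologicalSpace.denseRange_denseSeq E).exists_dist_lt δ (half_pos hε)
  refine ⟨γ (TopologicalSpace.denseSeq E k) ω, hω k z hz, ?_⟩
  have h1 := (hγ (TopologicalSpace.denseSeq E k) ω (hRne ω)).2 δ hδ
  rw [← dist_eq_norm, ← dist_eq_norm, dist_comm _ δ] at h1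
  linarith [dist_triangle δ (TopologicalSpace.denseSeq E k)
    (γ (TopologicalSpace.denseSeq E k) ω)]

/-- One-period duality, written with rational capitals so that the formula is a countable infimum
and is therefore measurable in `ω`. -/
theorem isLUB_reachableValues_of_hedge {K : Set (E × ℝ)} (hK : K.Nonempty) {C : Set E}
    (hC : IsPolyhedralCone C) {r : E} (hNA : NoOneStepArbitrage K C r)
    (hhedge : ∃ x, (hedgeSet Prod.snd K C r x).Nonempty) :
    IsLUB (reachableValues K C r) (⨅ q : ℚ, ⨅ _ : (hedgeSet Prod.snd K C r q).Nonempty,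
      ((q : ℝ) : EReal)).toReal := by
  obtain ⟨x, γ, hγ⟩ := hhedge
  have hlub := isLUB_csSup (reachableValues_nonempty hK hC hNA)
    ⟨x, fun y hy => le_of_mem_reachableValues hγ hy⟩
  have : (⨅ q : ℚ, ⨅ _ : (hedgeSet Prod.snd K C r q).Nonempty, ((q : ℝ) : EReal))
      = (sSup (reachableValues K C r) : ℝ) := by
    refine le_antisymm ?_ ?_
    · refine le_of_forall_gt_imp_ge_of_dense fun y hy => ?_
      obtain ⟨q, hq1, hq2⟩ := EReal.exists_rat_btwn_of_lt hy
      refine (iInf₂_le q ?_).trans hq2.le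
      exact hedgeSet_nonempty_of_lt hK hC hNA hlub.1 (by exact_mod_cast hq1)
    · refine le_iInf₂ fun q ⟨γ, hγ⟩ => ?_
      exact_mod_cast hlub.2 fun y hy => le_of_mem_reachableValues hγ hy
  rw [this, EReal.toReal_coe]
  exact hlub

/-- The least upper bound of the reachable values can be chosen measurably. -/
theorem exists_measurable_isLUB (hA : IsMeasurableSetValued m A)
    (hpoly : ∀ ω, IsPolyhedralCone (A ω)) (hs : Measurable[m] s) :
    ∃ p : Ω → ℝ, Measurable[m] p ∧
      ∀ ω, NoOneStepArbitrage (condSupport μ m η ω) (A ω) (s ω) →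
        (∃ x, (hedgeSet Prod.snd (condSupport μ m η ω) (A ω) (s ω) x).Nonempty) →
        IsLUB (reachableValues (condSupport μ m η ω) (A ω) (s ω)) (p ω) := by
  refine ⟨_, ?_, fun ω h1 h2 =>
    isLUB_reachableValues_of_hedge (condSupport_nonempty ω) (hpoly ω) h1 h2⟩
  refine @Measurable.comp _ _ _ m _ _ _ _ measurable_ereal_toReal ?_
  refine Measurable.iInf (mδ := m) fun q => ?_
  classical
  have hq : MeasurableSet[m]
      {ω | (hedgeSet Prod.snd (condSupport μ m η ω) (A ω) (s ω) q).Nonempty} := by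
    simpa using isMeasurableSetValued_condHedgeSet (μ := μ) (η := η) hA hpoly continuous_snd hs
      (@measurable_const _ _ _ m (q : ℝ)) univ isOpen_univ
  have : (fun ω => ⨅ _ : (hedgeSet Prod.snd (condSupport μ m η ω) (A ω) (s ω) q).Nonempty,
      ((q : ℝ) : EReal)) = fun ω =>
      if ω ∈ {ω | (hedgeSet Prod.snd (condSupport μ m η ω) (A ω) (s ω) q).Nonempty}
        then ((q : ℝ) : EReal) else ⊤ := by
    funext ω
    rw [iInf_eq_if]
    rfl
  rw [this]
  exact Measurable.ite hq measurable_const measurable_const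

/-- An arbitrarily small surplus over the least upper bound of the reachable values suffices to
hedge. -/
theorem exists_measurable_hedge (hm : m ≤ mΩ) (hη : Measurable η) (hA : IsMeasurableSetValued m A)
    (hpoly : ∀ ω, IsPolyhedralCone (A ω)) (hs : Measurable[m] s)
    (hNA : ∀ᵐ ω ∂μ, NoOneStepArbitrage (condSupport μ m η ω) (A ω) (s ω)) {p : Ω → ℝ}
    (hp : Measurable[m] p)
    (hlub : ∀ᵐ ω ∂μ, IsLUB (reachableValues (condSupport μ m η ω) (A ω) (s ω)) (p ω)) {ε : ℝ}
    (hε : 0 < ε) :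
    ∃ γ : Ω → E, Measurable[m] γ ∧ (∀ᵐ ω ∂μ, γ ω ∈ A ω) ∧
      ∀ᵐ ω ∂μ, (η ω).2 ≤ p ω + ε + inner ℝ (γ ω) ((η ω).1 - s ω) := by
  have hx : Measurable[m] fun ω => p ω + ε := hp.add_const ε
  obtain ⟨γ, hγm, hγ⟩ := @exists_measurable_closest_point d Ω m _
    (isMeasurableSetValued_condHedgeSet (μ := μ) (η := η) hA hpoly continuous_snd hs hx)
    (fun ω => isClosed_hedgeSet _ _ (hpoly ω).isClosed _ _)
    (fun ω => convex_hedgeSet _ _ (hpoly ω).convex _ _) 0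
  have hmem : ∀ᵐ ω ∂μ, γ ω ∈ hedgeSet Prod.snd (condSupport μ m η ω) (A ω) (s ω) (p ω + ε) := by
    filter_upwards [hNA, hlub] with ω h1 h2
    exact (hγ ω (hedgeSet_nonempty_of_lt (condSupport_nonempty ω) (hpoly ω) h1 h2.1
      (lt_add_of_pos_right _ hε))).1
  exact ⟨γ, hγm, hmem.mono fun ω h => h.1,
    (ae_hedge_iff hm μ hη continuous_snd hγm hs hx).2 (hmem.mono fun ω h => h.2)⟩

theorem ae_hedgeSet_nonempty (hm : m ≤ mΩ) (hη : Measurable η) (hs : Measurable[m] s)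
    {x : Ω → ℝ} (hx : Measurable[m] x) {γ : Ω → E} (hγ : Measurable[m] γ)
    (hγA : ∀ᵐ ω ∂μ, γ ω ∈ A ω)
    (hle : ∀ᵐ ω ∂μ, (η ω).2 ≤ x ω + inner ℝ (γ ω) ((η ω).1 - s ω)) :
    ∀ᵐ ω ∂μ, (hedgeSet Prod.snd (condSupport μ m η ω) (A ω) (s ω) (x ω)).Nonempty := by
  filter_upwards [hγA, (ae_hedge_iff hm μ hη continuous_snd hγ hs hx).1 hle] with ω h1 h2
  exact ⟨γ ω, h1, h2⟩

end ConditionalStep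

/-! ### Change of sign of the claim. -/

section Reflection

variable {d : ℕ} {Ω : Type*}

local notation "E" => EuclideanSpace ℝ (Fin d)

/-- The reflection `(s, y) ↦ (s, -y)`. -/
def reflection : (E × ℝ) ≃L[ℝ] (E × ℝ) :=
  (ContinuousLinearEquiv.refl ℝ E).prodCongr (ContinuousLinearEquiv.neg ℝ)

theorem reachableValues_reflection (K : Set (E × ℝ)) (A : Set E) (s : E) :
    reachableValues (reflection '' K) A s = -reachableValues K A s := by
  have h1 : intrinsicInterior ℝ (convexHull ℝ ((reflection : (E × ℝ) ≃L[ℝ] (E × ℝ)) '' K))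
      = reflection '' intrinsicInterior ℝ (convexHull ℝ K) := by
    have h2 := LinearMap.image_convexHull
      (reflection : (E × ℝ) ≃L[ℝ] (E × ℝ)).toLinearEquiv.toLinearMap K
    have h3 := (reflection : (E × ℝ) ≃L[ℝ] (E × ℝ)).toContinuousAffineEquiv.intrinsicInterior_image
      (convexHull ℝ K)
    refine Eq.trans ?_ h3
    exact congrArg _ h2.symm
  ext y
  simp only [reachableValues, h1, mem_ofPred_eq, Set.mem_neg, Set.mem_sub]
  constructor
  · rintro ⟨_, ⟨z, hz, rfl⟩, b, hb, hzb⟩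
    refine ⟨z, hz, b, hb, ?_⟩
    have hb2 : b.2 = 0 := hb.2
    have e1 := congrArg Prod.fst hzb
    have e2 := congrArg Prod.snd hzb
    simp [reflection, hb2] at e1 e2
    ext1 <;> simp [e1, ← e2, hb2]
  · rintro ⟨z, hz, b, hb, hzb⟩
    refine ⟨_, ⟨z, hz, rfl⟩, b, hb, ?_⟩
    have hb2 : b.2 = 0 := hb.2
    have e1 := congrArg Prod.fst hzb
    have e2 := congrArg Prod.snd hzb
    simp [hb2] at e1 e2
    ext1 <;> simp [reflection, e1, e2, hb2]

theorem support_map_homeomorph {X Y : Type*} [TopologicalSpace X] [MeasurableSpace X] [BorelSpace X]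
    [TopologicalSpace Y] [MeasurableSpace Y] [BorelSpace Y] (φ : X ≃ₜ Y) (ν : Measure X) :
    (ν.map φ).support = φ '' ν.support := by
  ext y
  rw [φ.image_eq_preimage_symm, mem_preimage, Measure.mem_support_iff_forall,
    Measure.mem_support_iff_forall]
  have hmap : ∀ U, ν.map φ U = ν (φ ⁻¹' U) := fun U => φ.measurableEmbedding.map_apply ν U
  constructor
  · intro h U hU
    have := h (φ.symm ⁻¹' U) (φ.symm.continuous.continuousAt hU)
    rwa [hmap, ← preimage_comp, φ.symm_comp_self, preimage_id] at this
  · intro h U hU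
    rw [hmap]
    refine h _ (φ.continuous.continuousAt ?_)
    rwa [φ.apply_symm_apply]

theorem ae_support_condDistrib_comp_homeomorph {β X : Type*} [MeasurableSpace Ω] [MeasurableSpace β]
    [TopologicalSpace X] [MeasurableSpace X] [BorelSpace X] [StandardBorelSpace X] [Nonempty X]
    {μ : Measure Ω} [IsFiniteMeasure μ] {Y : Ω → X} (hY : Measurable Y) {Z : Ω → β}
    (hZ : Measurable Z) (φ : X ≃ₜ X) :
    ∀ᵐ ω ∂μ, (condDistrib (φ ∘ Y) Z μ (Z ω)).support
      = φ '' (condDistrib Y Z μ (Z ω)).support := by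
  have h := condDistrib_comp (mβ := inferInstance) (μ := μ) Z hY.aemeasurable φ.measurable
  filter_upwards [ae_of_ae_map hZ.aemeasurable h] with ω hω
  rw [hω, Kernel.map_apply _ φ.measurable]
  exact support_map_homeomorph φ _

theorem condSupport_reflection {m mΩ : MeasurableSpace Ω} (hm : m ≤ mΩ) {μ : Measure Ω}
    [IsFiniteMeasure μ] {η : Ω → E × ℝ} (hη : Measurable η) :
    ∀ᵐ ω ∂μ, condSupport μ m (reflection ∘ η) ω = reflection '' condSupport μ m η ω :=
  @ae_support_condDistrib_comp_homeomorph Ω Ω (E × ℝ) mΩ m _ _ _ _ _ μ _ η hη id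
    (measurable_id'' hm) reflection.toHomeomorph

end Reflection

/-! ### Backward recursion and the upper price. -/

section Recursion

/-- The invariant `P` travels backward with the choices: each step is solvable only for inputs with
suitable measurability and bounds. -/
theorem exists_backward_recursion {X : Type*} {P : ℕ → X → Prop} {R : ℕ → X → X → Prop} (T : ℕ)
    (f : X) (hf : P T f) (step : ∀ t < T, ∀ p, P (t + 1) p → ∃ q, P t q ∧ R t p q) :
    ∃ π : ℕ → X, π T = f ∧ (∀ t ≤ T, P t (π t)) ∧ ∀ t < T, R t (π (t + 1)) (π t) := by
  induction T generalizing f with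
  | zero => exact ⟨fun _ => f, rfl, fun t ht => by simpa [Nat.le_zero.1 ht] using hf, by simp⟩
  | succ T ih =>
    obtain ⟨q, hq, hR⟩ := step T T.lt_succ_self f hf
    obtain ⟨π, hπT, hπP, hπR⟩ := ih q hq fun t ht => step t (ht.trans T.lt_succ_self)
    refine ⟨Function.update π (T + 1) f, Function.update_self .., fun t ht => ?_, fun t ht => ?_⟩
    · rcases ht.lt_or_eq with h | rfl
      · rw [Function.update_of_ne h.ne]
        exact hπP t (Nat.lt_succ_iff.1 h)
      · rwa [Function.update_self]
    · rw [Function.update_of_ne ht.ne]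
      rcases (Nat.lt_succ_iff.1 ht).lt_or_eq with h | rfl
      · rw [Function.update_of_ne (by omega)]
        exact hπR t h
      · rwa [Function.update_self, hπT]

variable {d : ℕ} {Ω : Type*}

local notation "E" => EuclideanSpace ℝ (Fin d)

theorem gain_succ (S γ : ℕ → Ω → E) (t : ℕ) (ω : Ω) :
    gain S γ (t + 1) ω = gain S γ t ω + inner ℝ (γ t ω) (S (t + 1) ω - S t ω) :=
  Finset.sum_range_succ _ _

variable {mΩ : MeasurableSpace Ω} {μ : Measure Ω} {F : Filtration ℕ mΩ} {T : ℕ}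
  {S : ℕ → Ω → EuclideanSpace ℝ (Fin d)} {B : ℕ → Ω → Set (EuclideanSpace ℝ (Fin d))}

theorem measurable_gain (hS : ∀ t ≤ T, Measurable[F t] (S t)) {γ : ℕ → Ω → E}
    (hγ : ∀ n < T, Measurable[F n] (γ n)) {t : ℕ} (ht : t ≤ T) :
    Measurable[F t] (gain S γ t) := by
  refine Finset.measurable_fun_sum (m := F t) _ fun n hn => ?_
  have hn : n < t := Finset.mem_range.1 hn
  have h1 : Measurable[F t] (γ n) := (hγ n (hn.trans_le ht)).mono (F.mono hn.le) le_rfl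
  have h2 : Measurable[F t] (S (n + 1)) := (hS _ (by omega)).mono (F.mono hn) le_rfl
  have h3 : Measurable[F t] (S n) := (hS n (by omega)).mono (F.mono hn.le) le_rfl
  exact h1.inner (h2.sub h3)

/-- The market has no arbitrage in a single trading period. -/
theorem NoArbitrage.single_step (hNA : NoArbitrage μ F T S B)
    (hBpoly : ∀ t < T, ∀ ω, IsPolyhedralCone (B t ω)) {t : ℕ} (ht : t < T) {γ : Ω → E}
    (hγ : Measurable[F t] γ) (hγB : ∀ ω, γ ω ∈ B t ω)
    (hpos : ∀ᵐ ω ∂μ, 0 ≤ inner ℝ (γ ω) (S (t + 1) ω - S t ω)) :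
    ∀ᵐ ω ∂μ, inner ℝ (γ ω) (S (t + 1) ω - S t ω) = (0 : ℝ) := by
  classical
  have hgain : ∀ ω, gain S (Function.update 0 t γ) T ω = inner ℝ (γ ω) (S (t + 1) ω - S t ω) := by
    intro ω
    rw [gain, Finset.sum_eq_single_of_mem t (Finset.mem_range.2 ht)]
    · rw [Function.update_self]
    · intro n _ hn
      rw [Function.update_of_ne hn]
      simp
  have := hNA (Function.update 0 t γ) (fun n hn => ?_) (by simpa only [hgain] using hpos)
  · simpa only [hgain] using this
  · rcases eq_or_ne n t with rfl | hne
    · rw [Function.update_self]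
      exact ⟨hγ, Filter.Eventually.of_forall hγB⟩
    · rw [Function.update_of_ne hne]
      exact ⟨measurable_const, Filter.Eventually.of_forall fun ω => (hBpoly n hn ω).zero_mem⟩

section Step

variable [IsFiniteMeasure μ]

theorem measurable_priceClaim (hS : ∀ t ≤ T, Measurable[F t] (S t)) {t : ℕ} (ht : t < T)
    {p : Ω → ℝ} (hp : Measurable[F (t + 1)] p) :
    Measurable fun ω => (S (t + 1) ω, p ω) :=
  ((hS _ ht).mono (F.le _) le_rfl).prodMk (hp.mono (F.le _) le_rfl)

theorem ae_noOneStepArbitrage_market (hNA : NoArbitrage μ F T S B)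
    (hS : ∀ t ≤ T, Measurable[F t] (S t)) (hBmeas : ∀ t < T, IsMeasurableSetValued (F t) (B t))
    (hBpoly : ∀ t < T, ∀ ω, IsPolyhedralCone (B t ω)) {t : ℕ} (ht : t < T)
    {p : Ω → ℝ} (hp : Measurable[F (t + 1)] p) :
    ∀ᵐ ω ∂μ, NoOneStepArbitrage (condSupport μ (F t) (fun ω' => (S (t + 1) ω', p ω')) ω)
      (B t ω) (S t ω) :=
  ae_noOneStepArbitrage (F.le t) (measurable_priceClaim hS ht hp) (hBmeas t ht) (hBpoly t ht)
    (hS t ht.le) fun _ h1 h2 h3 => hNA.single_step hBpoly ht h1 h2 h3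

theorem ae_hedgeSet_nonempty_market (hS : ∀ t ≤ T, Measurable[F t] (S t)) {γ : ℕ → Ω → E}
    (hγ : IsAdmissible μ F T B γ) {x : ℝ} {t : ℕ} (ht : t < T) {p : Ω → ℝ}
    (hp : Measurable[F (t + 1)] p) (hle : ∀ᵐ ω ∂μ, p ω ≤ x + gain S γ (t + 1) ω) :
    ∀ᵐ ω ∂μ, (hedgeSet Prod.snd (condSupport μ (F t) (fun ω' => (S (t + 1) ω', p ω')) ω)
      (B t ω) (S t ω) (x + gain S γ t ω)).Nonempty := by
  refine ae_hedgeSet_nonempty (F.le t) (measurable_priceClaim hS ht hp) (hS t ht.le)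
    ((measurable_gain hS (fun n hn => (hγ n hn).1) ht.le).const_add x) (hγ t ht).1 (hγ t ht).2 ?_
  filter_upwards [hle] with ω hω
  rw [gain_succ] at hω
  linarith

/-- A solution of the upper recursion is dominated by the value of every super-hedging portfolio. -/
theorem IsUpperRecursion.le_of_superHedge {f : Ω → ℝ} {π : ℕ → Ω → ℝ}
    (hπ : IsUpperRecursion μ F T S B f π) (hS : ∀ t ≤ T, Measurable[F t] (S t)) {γ : ℕ → Ω → E}
    (hγ : IsAdmissible μ F T B γ) {x : ℝ} (hf : ∀ᵐ ω ∂μ, f ω ≤ x + gain S γ T ω) {t : ℕ}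
    (ht : t ≤ T) : ∀ᵐ ω ∂μ, π t ω ≤ x + gain S γ t ω := by
  induction ht using Nat.decreasingInduction with
  | self =>
    filter_upwards [hf, hπ.2.1] with ω h1 h2
    rwa [h2]
  | of_succ t ht ih =>
    filter_upwards [ae_hedgeSet_nonempty_market hS hγ ht (hπ.1 _ ht) ih, hπ.2.2 t ht]
      with ω ⟨δ, hδ⟩ h2
    -- `stepValues` is by definition `reachableValues` of the conditional support.
    exact h2.2 fun y hy => le_of_mem_reachableValues hδ hy

theorem IsUpperRecursion.ae_eq {f : Ω → ℝ} {π π' : ℕ → Ω → ℝ}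
    (hπ : IsUpperRecursion μ F T S B f π) (hπ' : IsUpperRecursion μ F T S B f π') {t : ℕ}
    (ht : t ≤ T) : ∀ᵐ ω ∂μ, π' t ω = π t ω := by
  induction ht using Nat.decreasingInduction with
  | self =>
    filter_upwards [hπ.2.1, hπ'.2.1] with ω h1 h2
    rw [h1, h2]
  | of_succ t ht ih =>
    have hpair : (fun ω => (S (t + 1) ω, π' (t + 1) ω)) =ᵐ[μ]
        fun ω => (S (t + 1) ω, π (t + 1) ω) := by
      filter_upwards [ih] with ω hω
      rw [hω]
    -- The conditional distribution depends only on the a.s. class of the next value.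
    have hstep : ∀ ω, stepValues μ F S B t (π' (t + 1)) ω = stepValues μ F S B t (π (t + 1)) ω := by
      intro ω
      simp only [stepValues, condSupport, condDistrib_congr_left hpair]
    filter_upwards [hπ.2.2 t ht, hπ'.2.2 t ht] with ω h1 h2
    rw [hstep] at h2
    exact h2.unique h1

/-- The upper recursion is solvable for claims that can be super-hedged. -/
theorem exists_isUpperRecursion (hNA : NoArbitrage μ F T S B)
    (hS : ∀ t ≤ T, Measurable[F t] (S t)) (hBmeas : ∀ t < T, IsMeasurableSetValued (F t) (B t))
    (hBpoly : ∀ t < T, ∀ ω, IsPolyhedralCone (B t ω)) {f : Ω → ℝ} (hf : Measurable[F T] f)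
    {x : ℝ} (hx : IsSuperHedgeable μ F T S B f x) : ∃ π, IsUpperRecursion μ F T S B f π := by
  obtain ⟨γ, hγ, hfx⟩ := hx
  obtain ⟨π, h1, h2, h3⟩ := exists_backward_recursion
    -- Domination by the running value of the given super-hedge supplies the one-step hedge that
    -- makes the supremum finite.
    (P := fun t p => Measurable[F t] p ∧ ∀ᵐ ω ∂μ, p ω ≤ x + gain S γ t ω)
    (R := fun t p q => ∀ᵐ ω ∂μ, IsLUB (stepValues μ F S B t p ω) (q ω)) T f ⟨hf, hfx⟩ (by
      rintro t ht p ⟨hp, hle⟩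
      obtain ⟨q, hqm, hq⟩ := exists_measurable_isLUB (μ := μ)
        (η := fun ω' => (S (t + 1) ω', p ω')) (hBmeas t ht) (hBpoly t ht) (hS t ht.le)
      have hhedge := ae_hedgeSet_nonempty_market hS hγ ht hp hle
      have hlub : ∀ᵐ ω ∂μ, IsLUB (stepValues μ F S B t p ω) (q ω) := by
        filter_upwards [ae_noOneStepArbitrage_market hNA hS hBmeas hBpoly ht hp, hhedge]
          with ω h1 h2
        exact hq ω h1 ⟨_, h2⟩
      refine ⟨q, ⟨hqm, ?_⟩, hlub⟩
      filter_upwards [hlub, hhedge] with ω h1 ⟨δ, hδ⟩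
      exact h1.2 fun y hy => le_of_mem_reachableValues hδ hy)
  exact ⟨π, fun t ht => (h2 t ht).1, Filter.Eventually.of_forall fun ω => by rw [h1], h3⟩

/-- The initial value of the upper recursion, with an arbitrarily small surplus, suffices to
super-hedge. -/
theorem IsUpperRecursion.exists_hedge {f : Ω → ℝ} {π : ℕ → Ω → ℝ}
    (hπ : IsUpperRecursion μ F T S B f π) (hNA : NoArbitrage μ F T S B)
    (hS : ∀ t ≤ T, Measurable[F t] (S t)) (hBmeas : ∀ t < T, IsMeasurableSetValued (F t) (B t))
    (hBpoly : ∀ t < T, ∀ ω, IsPolyhedralCone (B t ω)) {ε : ℝ} (hε : 0 < ε) :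
    ∃ γ, IsAdmissible μ F T B γ ∧ ∀ᵐ ω ∂μ, f ω ≤ π 0 ω + T * ε + gain S γ T ω := by
  have hstep : ∀ t, ∃ γ : Ω → E, t < T → Measurable[F t] γ ∧ (∀ᵐ ω ∂μ, γ ω ∈ B t ω) ∧
      ∀ᵐ ω ∂μ, π (t + 1) ω ≤ π t ω + ε + inner ℝ (γ ω) (S (t + 1) ω - S t ω) := by
    intro t
    by_cases ht : t < T
    · obtain ⟨γ, h⟩ := exists_measurable_hedge (F.le t) (measurable_priceClaim hS ht (hπ.1 _ ht))
        (hBmeas t ht) (hBpoly t ht) (hS t ht.le)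
        (ae_noOneStepArbitrage_market hNA hS hBmeas hBpoly ht (hπ.1 _ ht)) (hπ.1 t ht.le)
        (hπ.2.2 t ht) hε
      exact ⟨γ, fun _ => h⟩
    · exact ⟨0, fun h => absurd h ht⟩
  choose γ hγ using hstep
  refine ⟨γ, fun n hn => ⟨(hγ n hn).1, (hγ n hn).2.1⟩, ?_⟩
  have hle : ∀ t ≤ T, ∀ᵐ ω ∂μ, π t ω ≤ π 0 ω + t * ε + gain S γ t ω := by
    intro t
    induction t with
    | zero => exact fun _ => Filter.Eventually.of_forall fun ω => by simp [gain]
    | succ t ih =>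
      intro ht
      filter_upwards [ih (by omega), (hγ t ht).2.2] with ω h1 h2
      rw [gain_succ]
      push_cast
      linarith
  filter_upwards [hle T le_rfl, hπ.2.1] with ω h1 h2
  rwa [← h2]

end Step

theorem ae_eq_const_of_trivial {m : MeasurableSpace Ω} (hm : m ≤ mΩ) [IsProbabilityMeasure μ]
    (htriv : ∀ s, MeasurableSet[m] s → μ s = 0 ∨ μ s = 1) {X : Ω → ℝ} (hX : Measurable[m] X) :
    ∃ c : ℝ, ∀ᵐ ω ∂μ, X ω = c := by
  refine Filter.exists_eventuallyEq_const_of_forall_separating MeasurableSet fun U hU => ?_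
  have hXU : MeasurableSet[m] (X ⁻¹' U) := hX hU
  rcases htriv _ hXU with h | h
  · exact Or.inr (measure_eq_zero_iff_ae_notMem.1 h)
  · exact Or.inl ((prob_compl_eq_zero_iff (hm _ hXU)).2 h)

/-- The initial value of the upper recursion is the upper price. -/
theorem IsUpperRecursion.zero_eq_upperPrice [IsProbabilityMeasure μ] {f : Ω → ℝ} {π : ℕ → Ω → ℝ}
    (hπ : IsUpperRecursion μ F T S B f π) (hNA : NoArbitrage μ F T S B)
    (hF0 : ∀ s : Set Ω, MeasurableSet[F 0] s → μ s = 0 ∨ μ s = 1)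
    (hS : ∀ t ≤ T, Measurable[F t] (S t)) (hBmeas : ∀ t < T, IsMeasurableSetValued (F t) (B t))
    (hBpoly : ∀ t < T, ∀ ω, IsPolyhedralCone (B t ω)) :
    ∀ᵐ ω ∂μ, (π 0 ω : EReal) = upperPrice μ F T S B f := by
  obtain ⟨c, hc⟩ := ae_eq_const_of_trivial (F.le 0) hF0 (hπ.1 0 T.zero_le)
  have hprice : upperPrice μ F T S B f = (c : EReal) := by
    refine le_antisymm (EReal.le_of_forall_lt_iff_le.1 fun y hy => ?_) (le_sInf ?_)
    · have hcy : c < y := EReal.coe_lt_coe_iff.1 hy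
      -- The surplus `y - c` is spread over the `T` periods; the divisor `T + 1` also covers `T =
      -- 0`.
      obtain ⟨γ, hγ, hle⟩ := hπ.exists_hedge hNA hS hBmeas hBpoly
        (div_pos (sub_pos.2 hcy) (by positivity : (0 : ℝ) < T + 1))
      refine sInf_le ⟨y, ⟨γ, hγ, ?_⟩, rfl⟩
      filter_upwards [hle, hc] with ω h1 h2
      have h3 : T * ((y - c) / (T + 1)) ≤ y - c := by
        rw [mul_div_assoc', div_le_iff₀ (by positivity)]
        nlinarith
      rw [h2] at h1
      linarith
    · rintro _ ⟨x, ⟨γ, hγ, hx⟩, rfl⟩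
      obtain ⟨ω, h1, h2⟩ := ((hπ.le_of_superHedge hS hγ hx T.zero_le).and hc).exists
      rw [h2] at h1
      simpa [gain] using h1
  filter_upwards [hc] with ω hω
  rw [hω, hprice]

end Recursion

/-! ### The lower price as the upper price of the negated claim. -/

section LowerPrice

variable {d : ℕ} {Ω : Type*} {mΩ : MeasurableSpace Ω} {μ : Measure Ω}
  {F : Filtration ℕ mΩ} {T : ℕ} {S : ℕ → Ω → EuclideanSpace ℝ (Fin d)}
  {B : ℕ → Ω → Set (EuclideanSpace ℝ (Fin d))}

theorem isSubHedgeable_iff {f : Ω → ℝ} {x : ℝ} :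
    IsSubHedgeable μ F T S B f x ↔ IsSuperHedgeable μ F T S B (-f) (-x) := by
  refine exists_congr fun γ => and_congr_right fun _ => Filter.eventually_congr ?_
  refine Filter.Eventually.of_forall fun ω => ?_
  rw [Pi.neg_apply]
  constructor <;> intro h <;> linarith

theorem lowerPrice_eq_neg_upperPrice (f : Ω → ℝ) :
    lowerPrice μ F T S B f = -upperPrice μ F T S B (-f) := by
  refine le_antisymm (sSup_le ?_) (EReal.neg_le.1 (le_sInf ?_))
  · rintro _ ⟨x, hx, rfl⟩
    refine EReal.le_neg_of_le_neg (sInf_le ⟨-x, isSubHedgeable_iff.1 hx, ?_⟩)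
    exact EReal.coe_neg x
  · rintro _ ⟨x, hx, rfl⟩
    refine EReal.neg_le.1 (le_sSup ⟨-x, isSubHedgeable_iff.2 ?_, EReal.coe_neg x⟩)
    rwa [neg_neg]

/-- Negating the claim reflects the conditional support almost surely, and the reflection commutes
with convex hulls and relative interiors and fixes the polar cone. -/
theorem ae_stepValues_neg [IsFiniteMeasure μ] {t : ℕ} (hS : Measurable (S (t + 1))) {p : Ω → ℝ}
    (hp : Measurable p) :
    ∀ᵐ ω ∂μ, stepValues μ F S B t (-p) ω = -stepValues μ F S B t p ω := by
  filter_upwards [condSupport_reflection (F.le t) (μ := μ) (hS.prodMk hp)] with ω hω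
  have h := reachableValues_reflection (condSupport μ (F t) (fun ω' => (S (t + 1) ω', p ω')) ω)
    (B t ω) (S t ω)
  rw [← hω] at h
  exact h

theorem isLowerRecursion_iff [IsFiniteMeasure μ] (hS : ∀ t ≤ T, Measurable[F t] (S t)) {f : Ω → ℝ}
    {π : ℕ → Ω → ℝ} :
    IsLowerRecursion μ F T S B f π ↔ IsUpperRecursion μ F T S B (-f) (-π) := by
  have hmeas : (∀ t ≤ T, Measurable[F t] (π t)) ↔ ∀ t ≤ T, Measurable[F t] ((-π) t) :=
    forall₂_congr fun t _ => ⟨fun h => h.neg, fun h => by simpa using h.neg⟩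
  unfold IsLowerRecursion IsUpperRecursion
  rw [← hmeas]
  refine and_congr_right fun hπ => and_congr ?_ (forall₂_congr fun t ht => ?_)
  · simp
  · have h1 := ae_stepValues_neg (μ := μ) (F := F) (B := B)
      ((hS (t + 1) ht).mono (F.le _) le_rfl) ((hπ (t + 1) ht).mono (F.le _) le_rfl)
    refine Filter.eventually_congr ?_
    filter_upwards [h1] with ω hω
    rw [Pi.neg_apply, Pi.neg_apply, Pi.neg_apply, hω, isLUB_neg]
    simp

end LowerPrice

end ConstrainedMarket

end

/-! ### The main theorem. -/

theorem theorem2 {d : ℕ} {Ω : Type*} {mΩ : MeasurableSpace Ω}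
    (μ : Measure Ω) [IsProbabilityMeasure μ] (F : Filtration ℕ mΩ) (T : ℕ)
    (hcomplete : ∀ t ≤ T, ∀ s : Set Ω, μ s = 0 → MeasurableSet[F t] s)
    (hF0 : ∀ s : Set Ω, MeasurableSet[F 0] s → μ s = 0 ∨ μ s = 1)
    (hFT : F T = mΩ)
    (S : ℕ → Ω → EuclideanSpace ℝ (Fin d))
    (hS : ∀ t ≤ T, Measurable[F t] (S t))
    (B : ℕ → Ω → Set (EuclideanSpace ℝ (Fin d)))
    (hBmeas : ∀ t < T, ConstrainedMarket.IsMeasurableSetValued (F t) (B t))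
    (hBpoly : ∀ t < T, ∀ ω, ConstrainedMarket.IsPolyhedralCone (B t ω))
    (hNA : ConstrainedMarket.NoArbitrage μ F T S B)
    (f : Ω → ℝ) (hf : Measurable[F T] f)
    (hupper : ConstrainedMarket.upperPrice μ F T S B f ≠ ⊥ ∧
      ConstrainedMarket.upperPrice μ F T S B f ≠ ⊤)
    (hlower : ConstrainedMarket.lowerPrice μ F T S B f ≠ ⊥ ∧
      ConstrainedMarket.lowerPrice μ F T S B f ≠ ⊤) :
    (∃ πu : ℕ → Ω → ℝ, ConstrainedMarket.IsUpperRecursion μ F T S B f πu ∧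
      (∀ π' : ℕ → Ω → ℝ, ConstrainedMarket.IsUpperRecursion μ F T S B f π' →
        ∀ t ≤ T, ∀ᵐ ω ∂μ, π' t ω = πu t ω) ∧
      ∀ᵐ ω ∂μ, (πu 0 ω : EReal) = ConstrainedMarket.upperPrice μ F T S B f) ∧
    (∃ πl : ℕ → Ω → ℝ, ConstrainedMarket.IsLowerRecursion μ F T S B f πl ∧
      (∀ π' : ℕ → Ω → ℝ, ConstrainedMarket.IsLowerRecursion μ F T S B f π' →
        ∀ t ≤ T, ∀ᵐ ω ∂μ, π' t ω = πl t ω) ∧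
      ∀ᵐ ω ∂μ, (πl 0 ω : EReal) = ConstrainedMarket.lowerPrice μ F T S B f) := by
  open ConstrainedMarket in
  have key : ∀ g : Ω → ℝ, Measurable[F T] g → upperPrice μ F T S B g ≠ ⊤ →
      ∃ π, IsUpperRecursion μ F T S B g π ∧
        ∀ᵐ ω ∂μ, (π 0 ω : EReal) = upperPrice μ F T S B g := by
    intro g hg htop
    -- The infimum of the empty set is `⊤`, so a price below `⊤` provides some super-hedge to start
    -- the recursion.
    obtain ⟨x, hx⟩ : {x | IsSuperHedgeable μ F T S B g x}.Nonempty := by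
      rw [nonempty_iff_ne_empty]
      intro hempty
      exact htop (by rw [upperPrice, hempty, image_empty, sInf_empty])
    obtain ⟨π, hπ⟩ := exists_isUpperRecursion hNA hS hBmeas hBpoly hg hx
    exact ⟨π, hπ, hπ.zero_eq_upperPrice hNA hF0 hS hBmeas hBpoly⟩
  constructor
  · obtain ⟨π, hπ, h0⟩ := key f hf hupper.2
    exact ⟨π, hπ, fun π' hπ' t ht => hπ.ae_eq hπ' ht, h0⟩
  · have hneg := ConstrainedMarket.lowerPrice_eq_neg_upperPrice (μ := μ) (F := F) (T := T) (S := S)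
      (B := B) f
    obtain ⟨π, hπ, h0⟩ := key (-f) hf.neg fun h => hlower.1 (by rw [hneg, h, EReal.neg_top])
    refine ⟨-π, (ConstrainedMarket.isLowerRecursion_iff hS).2 (by rwa [neg_neg]),
      fun π' hπ' t ht => ?_, ?_⟩
    · filter_upwards [hπ.ae_eq ((ConstrainedMarket.isLowerRecursion_iff hS).1 hπ') ht] with ω hω
      rw [Pi.neg_apply, Pi.neg_apply, ← hω, Pi.neg_apply, Pi.neg_apply, neg_neg]
    · filter_upwards [h0] with ω hω
      rw [hneg, ← hω, Pi.neg_apply, Pi.neg_apply, EReal.coe_neg]
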